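/- For complex $a,b,c,e,f$ write $_3F_2(a,b,c;e,f|1)=\sum_{k\ge 0}\frac{(a)_k(b)_k(c)_k}{(e)_k(f)_k\,k!}$, where $(x)_k=x(x+1)\cdots(x+k-1)$, and let $\sigma=e+f-a-b-c$ be its parametric excess. The series converges if $\operatorname{Re}\sigma>0$ or if it terminates (some upper parameter is in $\{0,-1,-2,\dots\}$); otherwise $_3F_2(a,b,c;e,f|1)$ denotes the analytic continuation of the sum in the lower parameter $f$ from the half-planes $\operatorname{Re} f\gg 0$. The symbol is defined if $e,f\notin\{0,-1,-2,\dots\}$ and either the series terminates or $\sigma\notin\{0,-1,-2,\dots\}$. The following identities hold for all complex values of the remaining parameters for which both sides are defined, i.e. the left-hand side is defined in the above sense, no denominator occurring in the formula vanishes (apart from poles of a Gamma function in a denominator, where $1/\Gamma=0$), and no Gamma function in a numerator is at a pole. In (1), (3), (5)–(14) $n$ is any integer $\ge 1$; in (2), (4), (15)–(22) $n$ is any integer $\ge 0$, and we put $K=\left(\frac{2a}{3}+\frac13\right)\frac{\Gamma(\frac52-3n)\,\Gamma(a-n+\frac12)}{\Gamma(\frac32+a-3n)\,\Gamma(\frac32-n)}$.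 (1) (the Gessel–Stanton evaluation ${}_3F_2(s+1-sa,a-1,-n;a+1,-s(n+a)-n|1)=\frac{a(1+s+sn)_n(n+1)}{(1+s(a+n))_n(a+n)}$ with $n\to-1-n$, where $(x)_{-k}=1/(x-k)_k$): $_3F_2(s+1-sa,\ a-1,\ n+1;\ a+1,\ -s(a-n-1)+n+1|1)=\dfrac{-an\,(s(a-n-1)-n)_{n+1}}{(-sn-n)_{n+1}\,(a-n-1)}$. (2) $_3F_2(2a,\,1-a,\,2n;\,2a+2,\,-a+3n-\frac12|1)=\dfrac{(2a+1)\Gamma(a-n+\frac12)\Gamma(-3n+\frac52)}{3\,\Gamma(\frac32-3n+a)\Gamma(\frac32-n)}$. (3) $_3F_2\left(a,\,b,\,-\frac{n(n-b+a)}{b-n};\,1+b-\frac{an}{b-n},\,1+a+n\Big|1\right)=\dfrac{(-1)^n\sin(\pi b)\,\Gamma(1+b+\frac{an}{n-b})\Gamma(-b)}{\sin(\pi a)\,\Gamma(1+a)\Gamma(-a-n)\Gamma(n+1+\frac{an}{n-b})}$. (4) $_3F_2(3n-\frac32,\,n-a-\frac12,\,2a;\,2a+\frac12+n,\,3n-a-\frac12|1)=K\,\dfrac{\Gamma(2a+\frac12+n)}{\Gamma(\frac12+n)\Gamma(2a+2)}$.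 (5) $_3F_2\left(a,\,b,\,-n+\frac{an}{b+n};\,1+b+\frac{an}{b+n},\,a-n+1\Big|1\right)=\dfrac{(-1)^n\sin(\pi b)\,\Gamma(1+b+\frac{an}{b+n})\Gamma(-b)}{\sin(\pi a)\,\Gamma(1+a)\Gamma(1-n+\frac{an}{b+n})\Gamma(n-a)}$. (6) $_3F_2\left(a,\,b,\,a-n-1;\,a-\frac{n(b-1)}{a-n-1},\,a-n+1\Big|1\right)=\sin\!\left(\pi\left(b-a+\tfrac{n(1-b)}{n+1-a}\right)\right)\dfrac{(n-a)(bn-a+1)\,\Gamma\!\left(a+\frac{n(b-1)}{n+1-a}\right)\Gamma\!\left(2-a+\frac{(1-a)(b-1)}{n+1-a}\right)\Gamma\!\left(2-b+\frac{n(b-1)}{n+1-a}\right)}{(b-a+n)(a-1)\,\pi\,\Gamma\!\left(2+\frac{n(b-1)}{n+1-a}\right)}$. (7) $_3F_2\left(2,\,a,\,1-n;\,b,\,2+\frac{n(1-a)}{b-2}\Big|1\right)=\dfrac{(an-b-n+2)(b-1)}{(1+a-b)(b+n-2)}$. (8) $_3F_2\left(a,\,b,\,-\frac{(a-1)(b-1)}{n};\,2+\frac{(b-1)(1-a)}{n},\,-1+a+b+n\Big|1\right)=\dfrac{\sin(\pi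 a)(-1)^n(n-ab+a+b-1)\,\Gamma(n)\Gamma(-a-n+1)\Gamma(-1+a+b+n)}{\pi\,\Gamma(b+n)}$. (9) $_3F_2\left(a,\,2,\,b;\,1+\frac{b(a-1)+n}{a+n-1},\,1+a+n\Big|1\right)=\dfrac{(n+ab-b)(a+n)}{(n-b+a)n}$. (10) $_3F_2\left(a,\,b,\,1+a+\frac{an}{1+a-b};\,2+a,\,1+a+n\Big|1\right)=-\dfrac{\sin\!\left(\frac{\pi na}{1+a-b}\right)(1+a)\,\Gamma\!\left(2-b-\frac{n(1-b)}{b-a-1}\right)\Gamma\!\left(\frac{n(b-1)}{1+a-b}\right)}{\sin(\pi a)\,\Gamma(-b+a+2+n)\Gamma(-a-n)}$. (11) $_3F_2\left(a,\,b,\,a+n-1;\,a-1+\frac{bn+a-1}{a+n-1},\,1+a+n\Big|1\right)=-\sin\!\left(\pi\left(a+\tfrac{(1-b)(a-1)}{a+n-1}\right)\right)\dfrac{(bn+a-1)(a+n)\,\Gamma\!\left(1+\frac{(b-1)(1-a)}{a+n-1}\right)\Gamma\!\left(a+\frac{n(b-1)}{a+n-1}\right)\Gamma\!\left(2-a+\frac{(b-1)(a-1)}{a+n-1}\right)}{(n-b+a)\,\pi\,(a-1)\,\Gamma\!\left(\frac{bn+a-1}{a+n-1}+1\right)}$.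 (12) $_3F_2\left(2,\,a,\,n+1;\,b,\,2+\frac{n(a-1)}{b-2}\Big|1\right)=-\dfrac{(-1)^n\sin\!\left(\pi\left(b-a+\frac{n(a-1)}{b-2}\right)\right)(an+b-2-n)(b-1)}{(1+a-b)(n+2-b)\,\sin\!\left(\frac{\pi(n+2-b)(1+a-b)}{b-2}\right)}$. (13) $_3F_2\left(a,\,2,\,b;\,2+\frac{(b-1)(a-1)}{a-n-1},\,a-n+1\Big|1\right)=\dfrac{(n-a)(n-ab+b)}{(b-a+n)n}$. (14) $_3F_2\left(a,\,b,\,1+a-\frac{an}{1+a-b};\,2+a,\,a-n+1\Big|1\right)=\dfrac{(1+a)\sin\!\left(\frac{\pi an}{1+a-b}\right)\Gamma\!\left(2-b+\frac{n(b-1)}{1+a-b}\right)\Gamma\!\left(-\frac{n(b-1)}{1+a-b}\right)}{\sin(\pi a)\,\Gamma(-b+a+2-n)\Gamma(n-a)}$. (15) $_3F_2(\frac12+n,\,3n-\frac32,\,3a+1;\,2a+\frac12+n,\,\frac12+3n|1)=K\,\dfrac{\Gamma(1-a)\Gamma(\frac12+3n)\Gamma(2a+\frac12+n)}{\Gamma(3n-a-\frac12)\Gamma(\frac12+n)\Gamma(2a+2)}$.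 (16) $_3F_2(\frac12+n,\,n-a-\frac12,\,2a+2-2n;\,2a+\frac12+n,\,\frac32-a+n|1)=K\,\dfrac{\Gamma(2n)\Gamma(\frac32-a+n)\Gamma(2a+\frac12+n)}{\Gamma(3n-a-\frac12)\Gamma(\frac12+n)\Gamma(2a+2)}$ (so $n\ge1$ here). (17) $_3F_2(3a+1,\,2a+2-2n,\,2a;\,2a+\frac12+n,\,2a+2|1)=K\,\dfrac{\Gamma(2a+\frac12+n)\Gamma(3n-3a-\frac12)}{\Gamma(3n-a-\frac12)\Gamma(\frac12+n)}$. (18) $_3F_2(\frac12+n,\,3n-3a-\frac12,\,2;\,\frac12+3n,\,\frac32-a+n|1)=K\,\dfrac{\Gamma(2a)\Gamma(\frac32-a+n)\Gamma(\frac12+3n)}{\Gamma(3n-a-\frac12)\Gamma(\frac12+n)\Gamma(2a+2)}$. (19) $_3F_2(3n-\frac32,\,3n-3a-\frac12,\,2n;\,\frac12+3n,\,3n-a-\frac12|1)=K\,\dfrac{\Gamma(2a+2-2n)\Gamma(\frac12+3n)}{\Gamma(\frac12+n)\Gamma(2a+2)}$. (20) $_3F_2(3a+1,\,2,\,2n;\,\frac12+3n,\,2a+2|1)=K\,\dfrac{\Gamma(n-a-\frac12)\Gamma(\frac12+3n)}{\Gamma(3n-a-\frac12)\Gamma(\frac12+n)}$.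 (21) $_3F_2(n-a-\frac12,\,3n-3a-\frac12,\,1-a;\,\frac32-a+n,\,3n-a-\frac12|1)=K\,\dfrac{\Gamma(3a+1)\Gamma(\frac32-a+n)}{\Gamma(\frac12+n)\Gamma(2a+2)}$. (22) $_3F_2(2a+2-2n,\,2,\,1-a;\,\frac32-a+n,\,2a+2|1)=K\,\dfrac{\Gamma(3n-\frac32)\Gamma(\frac32-a+n)}{\Gamma(3n-a-\frac12)\Gamma(\frac12+n)}$. -/

import Mathlib

open Complex

/-- `z` is one of `0, -1, -2, …` (the poles of the Gamma function). -/
def IsGammaPole (z : ℂ) : Prop := ∃ m : ℕ, z = -(m : ℂ)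

/-- The rising factorial `(x)_k = x (x + 1) ⋯ (x + k - 1)`. -/
noncomputable def poch (x : ℂ) (k : ℕ) : ℂ := (ascPochhammer ℂ k).eval x

/-- The `k`-th term of the series `₃F₂(a, b, c; e, f | 1)`. -/
noncomputable def hyp3F2Term (a b c e f : ℂ) (k : ℕ) : ℂ :=
  poch a k * poch b k * poch c k / (poch e k * poch f k * (k.factorial : ℂ))

/-- The parametric excess of `₃F₂(a, b, c; e, f | 1)`. -/
def excess (a b c e f : ℂ) : ℂ := e + f - a - b - c

/-- The series with upper parameters `a, b, c` terminates. -/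
def Terminates (a b c : ℂ) : Prop := IsGammaPole a ∨ IsGammaPole b ∨ IsGammaPole c

/-- The parameters for which `₃F₂(a, b, c; e, f | 1)`, as a series or by analytic continuation,
is defined: no lower parameter is a non-positive integer, and the excess is not a non-positive
integer either (those are poles of the continuation) unless the series terminates. -/
def Admissible (a b c e f : ℂ) : Prop :=
  ¬ IsGammaPole e ∧ ¬ IsGammaPole f ∧ (Terminates a b c ∨ ¬ IsGammaPole (excess a b c e f))

/-- `₃F₂(a, b, c; e, f | 1) = v`. Where the excess has positive real part, or the series
terminates, the series converges (absolutely) to `v`. In every case `v` is the value at the given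
lower parameter `f` of the analytic continuation of the sum of the series as a function of that
parameter, which is holomorphic where its real part is large. -/
structure Hyp3F2AtOne (a b c e f v : ℂ) : Prop where
  hasSum : (0 < (excess a b c e f).re ∨ Terminates a b c) → HasSum (hyp3F2Term a b c e f) v
  continuation : ∃ (U : Set ℂ) (G : ℂ → ℂ) (R : ℝ),
    IsOpen U ∧ IsPreconnected U ∧ DifferentiableOn ℂ G U ∧
    (∀ z : ℂ, R < z.re → z ∈ U ∧ HasSum (hyp3F2Term a b c e z) (G z)) ∧
    f ∈ U ∧ G f = v

/-!
Every evaluation is one of three elementary ones, possibly after permuting upper or lower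
parameters and rewriting Gamma functions by reflection. Let `σ = e + f - a - b - c` be the excess.

* Upper parameter `2` (`isHyp3F2Value_two`): if `(a - 1) (c - 1) = (e - 2) (f - 2)`, then
  `₃F₂(2, a, c; e, f | 1) = (e - 1) (f - 1) / σ`. The series is Gosper-summable: its terms are
  differences of a multiple of `(a)_k (c)_k / ((e)_{k-1} (f)_{k-1})`.
* Excess `2` (`isHyp3F2Value_excess_two`): if `a b + b c + c a = (e - 1) (f - 1)`, the partial sums
  are terms of `₃F₂(a + 1, b + 1, c + 1; e, f | 1)`, and their limit is
  `Γ(e) Γ(f) / (Γ(a + 1) Γ(b + 1) Γ(c + 1))`.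
* Lower parameter `e = a + 2` (`isHyp3F2Value_add_two`): if
  `(f - a - 1) a + (b - a - 1) (c - a - 1) = 0`, the terms differ from those of
  `(a + 1) ₂F₁(b - 1, c - 1; f | 1)` by a telescoping sum, and Gauss's theorem `tsum_gauss` applies.

Unless `σ` is a pole, each value is `Γ(e) Γ(f) Γ(σ)` times three reciprocal Gamma values. For the
one-parameter family these three are the same throughout, which leaves the single identity
`Gamma_quotient_eq`.

Where the excess has non-positive real part the series must be continued. The continuation
`hyp3F2Cont` is obtained by iterating a contiguous relation (`hyp3F2_contiguous`) that raises the
excess and is symmetric in the upper and in the lower parameters. Hence the continuation has the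
same symmetries; in particular it does not matter which lower parameter is continued.

The conditions in the three evaluations are not preserved when one lower parameter `z` varies, so
the evaluations are not continued directly. For arbitrary `z` the telescoping argument leaves an
error term: a coefficient, rational in `z`, times the continuation of another `₃F₂`
(`hyp3F2Cont_two`, `hyp3F2Cont_add_two`). Such a relation extends to all `z` by the identity
theorem, and at the parameter in question its coefficient vanishes.

If the series terminates and the excess is a pole, the value is the finite sum
(`IsHyp3F2Value`); this concerns only evaluations with an upper parameter `2`, where the
telescoping is exact, and two trivial cases of the Gessel–Stanton evaluation.
-/

open Filter Topology

/-! ### Poles, rising factorials and terms -/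

theorem IsGammaPole.not_add_natCast {x : ℂ} (h : ¬ IsGammaPole x) (n : ℕ) :
    ¬ IsGammaPole (x + n) := by
  rintro ⟨m, hm⟩
  exact h ⟨m + n, by push_cast; linear_combination hm⟩

theorem IsGammaPole.not_add_one {x : ℂ} (h : ¬ IsGammaPole x) : ¬ IsGammaPole (x + 1) := by
  simpa using IsGammaPole.not_add_natCast h 1

theorem IsGammaPole.not_add_two {x : ℂ} (h : ¬ IsGammaPole x) : ¬ IsGammaPole (x + 2) := by
  simpa using IsGammaPole.not_add_natCast h 2

theorem IsGammaPole.ne_zero_of_not {x : ℂ} (h : ¬ IsGammaPole x) : x ≠ 0 := by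
  rintro rfl
  exact h ⟨0, by simp⟩

theorem IsGammaPole.add_natCast_ne_zero {x : ℂ} (h : ¬ IsGammaPole x) (n : ℕ) : x + n ≠ 0 :=
  IsGammaPole.ne_zero_of_not (IsGammaPole.not_add_natCast h n)

theorem not_isGammaPole_of_re_pos {x : ℂ} (h : 0 < x.re) : ¬ IsGammaPole x := by
  rintro ⟨m, rfl⟩
  simp only [neg_re, natCast_re, Left.neg_pos_iff] at h
  exact absurd h (not_lt.mpr m.cast_nonneg)

theorem Gamma_ne_zero_of_not_isGammaPole {x : ℂ} (h : ¬ IsGammaPole x) : Gamma x ≠ 0 :=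
  Gamma_ne_zero fun m hm => h ⟨m, hm⟩

theorem Gamma_eq_zero_of_isGammaPole {x : ℂ} (h : IsGammaPole x) : Gamma x = 0 :=
  (Gamma_eq_zero_iff x).mpr h

theorem poch_zero (x : ℂ) : poch x 0 = 1 := by simp [poch]

theorem poch_succ (x : ℂ) (k : ℕ) : poch x (k + 1) = poch x k * (x + k) :=
  ascPochhammer_succ_eval k x

theorem poch_succ_left (x : ℂ) (k : ℕ) : poch x (k + 1) = x * poch (x + 1) k := by
  induction k with
  | zero => simp [poch_succ, poch_zero]
  | succ k ih =>
    rw [poch_succ, ih, poch_succ]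
    push_cast
    ring

theorem poch_add_one_mul (x : ℂ) (k : ℕ) : x * poch (x + 1) k = poch x k * (x + k) := by
  rw [← poch_succ_left, poch_succ]

theorem poch_eq_prod (x : ℂ) (k : ℕ) : poch x k = ∏ j ∈ Finset.range k, (x + j) := by
  induction k with
  | zero => simp [poch_zero]
  | succ k ih => rw [poch_succ, ih, Finset.prod_range_succ]

theorem poch_one (k : ℕ) : poch 1 k = (k.factorial : ℂ) := by
  induction k with
  | zero => simp [poch_zero]
  | succ k ih => rw [poch_succ, ih, Nat.factorial_succ]; push_cast; ring

theorem poch_ne_zero {x : ℂ} (h : ¬ IsGammaPole x) (k : ℕ) : poch x k ≠ 0 := by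
  rw [poch_eq_prod, Finset.prod_ne_zero_iff]
  exact fun j _ => IsGammaPole.add_natCast_ne_zero h j

theorem poch_neg_natCast_eq_zero {m k : ℕ} (h : m < k) : poch (-(m : ℂ)) k = 0 := by
  rw [poch_eq_prod, Finset.prod_eq_zero_iff]
  exact ⟨m, Finset.mem_range.mpr h, by simp⟩

theorem differentiable_poch (k : ℕ) : Differentiable ℂ fun z => poch z k := by
  unfold poch
  exact Polynomial.differentiable _

theorem hyp3F2Term_zero (a b c e f : ℂ) : hyp3F2Term a b c e f 0 = 1 := by
  simp [hyp3F2Term, poch_zero]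

theorem hyp3F2Term_swap_lower (a b c e f : ℂ) : hyp3F2Term a b c e f = hyp3F2Term a b c f e := by
  funext k; simp only [hyp3F2Term]; ring

theorem hyp3F2Term_swap_upper (a b c e f : ℂ) : hyp3F2Term a b c e f = hyp3F2Term b a c e f := by
  funext k; simp only [hyp3F2Term]; ring

theorem hyp3F2Term_swap_upper' (a b c e f : ℂ) : hyp3F2Term a b c e f = hyp3F2Term a c b e f := by
  funext k; simp only [hyp3F2Term]; ring

/-! ### Growth of the terms -/

/-- Gauss's product formula for `1 / Γ`, valid at the poles of `Γ` as well. -/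
theorem tendsto_poch_mul_cpow (s : ℂ) :
    Tendsto (fun k : ℕ => poch s k * (k : ℂ) ^ (1 - s) / (k.factorial : ℂ)) atTop
      (𝓝 (Gamma s)⁻¹) := by
  by_cases h : IsGammaPole s
  · rw [Gamma_eq_zero_of_isGammaPole h, inv_zero]
    obtain ⟨m, rfl⟩ := h
    refine tendsto_const_nhds.congr' ?_
    filter_upwards [eventually_gt_atTop m] with k hk
    simp [poch_neg_natCast_eq_zero hk]
  · have h1 := (GammaSeq_tendsto_Gamma s).inv₀ (Gamma_ne_zero_of_not_isGammaPole h)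
    have h2 : Tendsto (fun k : ℕ => ((k : ℂ) / (k + s))) atTop (𝓝 1) :=
      tendsto_natCast_div_add_atTop s
    have h3 := h1.mul h2
    rw [mul_one] at h3
    refine h3.congr' ?_
    filter_upwards [eventually_gt_atTop 0] with k hk
    have hk' : (k : ℂ) ≠ 0 := by exact_mod_cast hk.ne'
    have hs : (k : ℂ) + s ≠ 0 := by rw [add_comm]; exact IsGammaPole.add_natCast_ne_zero h k
    have hks : (k : ℂ) ^ s ≠ 0 := by simp [cpow_eq_zero_iff, hk']
    have hf : (k.factorial : ℂ) ≠ 0 := by exact_mod_cast k.factorial_ne_zero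
    rw [GammaSeq, ← poch_eq_prod, poch_succ, cpow_sub _ _ hk', cpow_one]
    field_simp
    ring

theorem tendsto_hyp3F2Term_mul_cpow {a b c e f : ℂ} (he : ¬ IsGammaPole e)
    (hf : ¬ IsGammaPole f) :
    Tendsto (fun k : ℕ => hyp3F2Term a b c e f k * (k : ℂ) ^ (excess a b c e f + 1)) atTop
      (𝓝 (Gamma e * Gamma f * (Gamma a)⁻¹ * (Gamma b)⁻¹ * (Gamma c)⁻¹)) := by
  have key := ((((tendsto_poch_mul_cpow e).inv₀
    (inv_ne_zero (Gamma_ne_zero_of_not_isGammaPole he))).mul ((tendsto_poch_mul_cpow f).inv₀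
    (inv_ne_zero (Gamma_ne_zero_of_not_isGammaPole hf)))).mul (tendsto_poch_mul_cpow a)).mul
    (tendsto_poch_mul_cpow b) |>.mul (tendsto_poch_mul_cpow c)
  simp only [inv_inv] at key
  refine key.congr' ?_
  filter_upwards [eventually_gt_atTop 0] with k hk
  have hk' : (k : ℂ) ≠ 0 := by exact_mod_cast hk.ne'
  have hp : ∀ s : ℂ, (k : ℂ) ^ s ≠ 0 := fun s => by simp [cpow_eq_zero_iff, hk']
  have hfac : (k.factorial : ℂ) ≠ 0 := by exact_mod_cast k.factorial_ne_zero
  have h1 := poch_ne_zero he k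
  have h2 := poch_ne_zero hf k
  have hx : (k : ℂ) ^ (excess a b c e f + 1) = (k : ℂ) ^ (1 - a) * (k : ℂ) ^ (1 - b) *
      (k : ℂ) ^ (1 - c) / ((k : ℂ) ^ (1 - e) * (k : ℂ) ^ (1 - f)) := by
    rw [← cpow_add _ _ hk', ← cpow_add _ _ hk', ← cpow_add _ _ hk', ← cpow_sub _ _ hk']
    congr 1
    simp only [excess]; ring
  rw [hx, hyp3F2Term]
  have := hp (1 - e)
  have := hp (1 - f)
  field_simp

theorem hyp3F2Term_isBigO {a b c e f : ℂ} (he : ¬ IsGammaPole e) (hf : ¬ IsGammaPole f) :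
    hyp3F2Term a b c e f =O[atTop] fun k : ℕ => (k : ℝ) ^ (-(excess a b c e f).re - 1) := by
  have h := (tendsto_hyp3F2Term_mul_cpow (a := a) (b := b) (c := c) he hf).isBigO_one ℂ
  have h2 := h.mul (Asymptotics.isBigO_refl
    (fun k : ℕ => (k : ℂ) ^ (-(excess a b c e f) - 1)) atTop)
  refine (h2.congr' (f₂ := hyp3F2Term a b c e f) ?_ EventuallyEq.rfl).trans ?_
  · filter_upwards [eventually_gt_atTop 0] with k hk
    have hk' : (k : ℂ) ≠ 0 := by exact_mod_cast hk.ne'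
    rw [mul_assoc, ← cpow_add _ _ hk']
    simp
  · refine Asymptotics.IsBigO.of_bound 1 ?_
    filter_upwards [eventually_gt_atTop 0] with k hk
    rw [one_mul, one_mul, norm_natCast_cpow_of_pos hk, Real.norm_eq_abs]
    exact le_abs_self _

theorem summable_norm_hyp3F2Term {a b c e f : ℂ} (he : ¬ IsGammaPole e) (hf : ¬ IsGammaPole f)
    (hs : 0 < (excess a b c e f).re) : Summable fun k => ‖hyp3F2Term a b c e f k‖ := by
  refine summable_of_isBigO_nat (Real.summable_nat_rpow.mpr ?_)
    (hyp3F2Term_isBigO (a := a) (b := b) (c := c) he hf).norm_left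
  linarith

theorem hasSum_hyp3F2Term {a b c e f : ℂ} (he : ¬ IsGammaPole e) (hf : ¬ IsGammaPole f)
    (hs : 0 < (excess a b c e f).re) :
    HasSum (hyp3F2Term a b c e f) (∑' k, hyp3F2Term a b c e f k) :=
  (summable_norm_hyp3F2Term he hf hs).of_norm.hasSum

theorem tendsto_hyp3F2Term_zero {a b c e f : ℂ} (he : ¬ IsGammaPole e) (hf : ¬ IsGammaPole f)
    (hs : -1 < (excess a b c e f).re) : Tendsto (hyp3F2Term a b c e f) atTop (𝓝 0) := by
  refine (hyp3F2Term_isBigO he hf).trans_tendsto ?_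
  have := (tendsto_rpow_neg_atTop (y := (excess a b c e f).re + 1) (by linarith)).comp
    (tendsto_natCast_atTop_atTop (R := ℝ))
  refine this.congr fun k => ?_
  simp only [Function.comp]
  congr 1; ring

/-! ### A symmetric contiguous relation -/

theorem IsGammaPole.add_one_add_natCast_ne_zero {x : ℂ} (h : ¬ IsGammaPole x) (n : ℕ) :
    x + 1 + n ≠ 0 :=
  IsGammaPole.add_natCast_ne_zero (IsGammaPole.not_add_one h) n

theorem poch_add_two {x : ℂ} (h : ¬ IsGammaPole x) (k : ℕ) :
    poch (x + 2) k = poch (x + 1) k * (x + 1 + k) / (x + 1) := by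
  have h1 := IsGammaPole.ne_zero_of_not (IsGammaPole.not_add_one h)
  rw [eq_div_iff h1, ← poch_add_one_mul, show x + 1 + 1 = x + 2 by ring]
  ring

/-- The telescoped form, for partial sums, of the contiguous relation `hyp3F2_contiguous`. -/
theorem sum_range_contiguous {a b c e f : ℂ} (he : ¬ IsGammaPole e) (hf : ¬ IsGammaPole f)
    (K : ℕ) :
    ∑ k ∈ Finset.range (K + 1),
        ((a * b * c + excess a b c e f * e * f) * hyp3F2Term a b c (e + 1) (f + 1) k -
          excess a b c e f * e * f * hyp3F2Term a b c e f k) +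
      ∑ k ∈ Finset.range K,
        (a * b + b * c + c * a - e * f + excess a b c e f * (e + f)) *
          (a * b * c / ((e + 1) * (f + 1))) *
          hyp3F2Term (a + 1) (b + 1) (c + 1) (e + 2) (f + 2) k =
    a * b * c * hyp3F2Term (a + 1) (b + 1) (c + 1) (e + 1) (f + 1) K := by
  induction K with
  | zero =>
    simp only [zero_add, Finset.sum_range_one, Finset.sum_range_zero, hyp3F2Term_zero]
    ring
  | succ K ih =>
    rw [Finset.sum_range_succ _ K, Finset.sum_range_succ _ (K + 1)]
    have e0 := IsGammaPole.ne_zero_of_not he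
    have f0 := IsGammaPole.ne_zero_of_not hf
    have e1 := IsGammaPole.ne_zero_of_not (IsGammaPole.not_add_one he)
    have f1 := IsGammaPole.ne_zero_of_not (IsGammaPole.not_add_one hf)
    have eK := IsGammaPole.add_one_add_natCast_ne_zero he K
    have fK := IsGammaPole.add_one_add_natCast_ne_zero hf K
    have eP := poch_ne_zero (IsGammaPole.not_add_one he) K
    have fP := poch_ne_zero (IsGammaPole.not_add_one hf) K
    have hK : (K.factorial : ℂ) ≠ 0 := by exact_mod_cast K.factorial_ne_zero
    have hK1 : (K : ℂ) + 1 ≠ 0 := by exact_mod_cast K.succ_ne_zero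
    have hstep : ((a * b * c + excess a b c e f * e * f) *
          hyp3F2Term a b c (e + 1) (f + 1) (K + 1) -
          excess a b c e f * e * f * hyp3F2Term a b c e f (K + 1)) +
        (a * b + b * c + c * a - e * f + excess a b c e f * (e + f)) *
          (a * b * c / ((e + 1) * (f + 1))) *
          hyp3F2Term (a + 1) (b + 1) (c + 1) (e + 2) (f + 2) K =
        a * b * c * hyp3F2Term (a + 1) (b + 1) (c + 1) (e + 1) (f + 1) (K + 1) -
        a * b * c * hyp3F2Term (a + 1) (b + 1) (c + 1) (e + 1) (f + 1) K := by
      simp only [hyp3F2Term, excess]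
      rw [poch_succ_left a, poch_succ_left b, poch_succ_left c, poch_succ_left e,
        poch_succ_left f, poch_succ (e + 1), poch_succ (f + 1), poch_succ (a + 1),
        poch_succ (b + 1), poch_succ (c + 1), poch_add_two he, poch_add_two hf,
        Nat.factorial_succ]
      push_cast
      field_simp
      ring
    linear_combination ih + hstep

theorem excess_add_one_add_one (a b c e f : ℂ) :
    excess a b c (e + 1) (f + 1) = excess a b c e f + 2 := by
  simp only [excess]; ring

theorem excess_shift (a b c e f : ℂ) :
    excess (a + 1) (b + 1) (c + 1) (e + 2) (f + 2) = excess a b c e f + 1 := by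
  simp only [excess]; ring

theorem excess_shift' (a b c e f : ℂ) :
    excess (a + 1) (b + 1) (c + 1) (e + 1) (f + 1) = excess a b c e f - 1 := by
  simp only [excess]; ring

/-- If partial sums of two convergent series combine to a null sequence, so do their sums. -/
theorem HasSum.add_eq_of_tendsto {u v : ℕ → ℂ} {x y l : ℂ} {w : ℕ → ℂ} (hu : HasSum u x)
    (hv : HasSum v y) (hw : Tendsto w atTop (𝓝 l))
    (h : ∀ K, ∑ k ∈ Finset.range (K + 1), u k + ∑ k ∈ Finset.range K, v k = w K) :
    x + y = l := by
  have h1 := (hu.tendsto_sum_nat.comp (tendsto_add_atTop_nat 1)).add hv.tendsto_sum_nat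
  exact tendsto_nhds_unique (h1.congr h) hw

theorem hyp3F2_contiguous {a b c e f : ℂ} (he : ¬ IsGammaPole e) (hf : ¬ IsGammaPole f)
    (hs : 0 < (excess a b c e f).re) :
    excess a b c e f * e * f * ∑' k, hyp3F2Term a b c e f k =
      (a * b * c + excess a b c e f * e * f) * ∑' k, hyp3F2Term a b c (e + 1) (f + 1) k +
      (a * b + b * c + c * a - e * f + excess a b c e f * (e + f)) *
          (a * b * c / ((e + 1) * (f + 1))) *
          ∑' k, hyp3F2Term (a + 1) (b + 1) (c + 1) (e + 2) (f + 2) k := by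
  have he1 := IsGammaPole.not_add_one he
  have hf1 := IsGammaPole.not_add_one hf
  have h0 := hasSum_hyp3F2Term he hf hs
  have h1 := hasSum_hyp3F2Term (a := a) (b := b) (c := c) he1 hf1
    (by rw [excess_add_one_add_one, add_re, re_ofNat]; linarith)
  have h2 := hasSum_hyp3F2Term (a := a + 1) (b := b + 1) (c := c + 1)
    (IsGammaPole.not_add_two he) (IsGammaPole.not_add_two hf)
    (by rw [excess_shift, add_re, one_re]; linarith)
  have h3 := (tendsto_hyp3F2Term_zero (a := a + 1) (b := b + 1) (c := c + 1) he1 hf1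
    (by rw [excess_shift', sub_re, one_re]; linarith)).const_mul (a * b * c)
  have := HasSum.add_eq_of_tendsto ((h1.mul_left _).sub (h0.mul_left _)) (h2.mul_left _) h3
    (sum_range_contiguous he hf)
  rw [mul_zero] at this
  linear_combination -this

/-! ### The continuation -/

/-- `N` applications of the contiguous relation `hyp3F2_contiguous` to the sum of the series.
This is the value of the continuation of `₃F₂(a, b, c; e, f | 1)` as soon as the real part of the
excess is larger than `-N`. -/
noncomputable def hyp3F2Aux : ℕ → ℂ → ℂ → ℂ → ℂ → ℂ → ℂ
  | 0, a, b, c, e, f => ∑' k, hyp3F2Term a b c e f k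
  | N + 1, a, b, c, e, f =>
    ((a * b * c + excess a b c e f * e * f) * hyp3F2Aux N a b c (e + 1) (f + 1) +
      (a * b + b * c + c * a - e * f + excess a b c e f * (e + f)) *
          (a * b * c / ((e + 1) * (f + 1))) *
          hyp3F2Aux N (a + 1) (b + 1) (c + 1) (e + 2) (f + 2)) / (excess a b c e f * e * f)

/-- The analytic continuation of `₃F₂(a, b, c; e, f | 1)`, meaningful when neither `e`, `f` nor
the excess is a pole of the Gamma function. -/
noncomputable def hyp3F2Cont (a b c e f : ℂ) : ℂ :=
  hyp3F2Aux (⌊-(excess a b c e f).re⌋₊ + 1) a b c e f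

theorem excess_swap_lower (a b c e f : ℂ) : excess a b c e f = excess a b c f e := by
  simp only [excess]; ring

theorem excess_swap_upper (a b c e f : ℂ) : excess a b c e f = excess b a c e f := by
  simp only [excess]; ring

theorem excess_swap_upper' (a b c e f : ℂ) : excess a b c e f = excess a c b e f := by
  simp only [excess]; ring

theorem hyp3F2Aux_swap_lower (N : ℕ) (a b c e f : ℂ) :
    hyp3F2Aux N a b c e f = hyp3F2Aux N a b c f e := by
  induction N generalizing a b c e f with
  | zero => simp only [hyp3F2Aux, hyp3F2Term_swap_lower a b c e f]
  | succ N ih =>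
    simp only [hyp3F2Aux, ih _ _ _ (e + 1), ih _ _ _ (e + 2), excess_swap_lower a b c e f]
    congr 1 <;> ring

theorem hyp3F2Aux_swap_upper (N : ℕ) (a b c e f : ℂ) :
    hyp3F2Aux N a b c e f = hyp3F2Aux N b a c e f := by
  induction N generalizing a b c e f with
  | zero => simp only [hyp3F2Aux, hyp3F2Term_swap_upper a b c e f]
  | succ N ih =>
    simp only [hyp3F2Aux, ih a, ih (a + 1), excess_swap_upper a b c e f]
    congr 1; ring

theorem hyp3F2Aux_swap_upper' (N : ℕ) (a b c e f : ℂ) :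
    hyp3F2Aux N a b c e f = hyp3F2Aux N a c b e f := by
  induction N generalizing a b c e f with
  | zero => simp only [hyp3F2Aux, hyp3F2Term_swap_upper' a b c e f]
  | succ N ih =>
    simp only [hyp3F2Aux, ih a b, ih (a + 1) (b + 1), excess_swap_upper' a b c e f]
    congr 1; ring

theorem hyp3F2Cont_swap_lower (a b c e f : ℂ) :
    hyp3F2Cont a b c e f = hyp3F2Cont a b c f e := by
  rw [hyp3F2Cont, hyp3F2Cont, hyp3F2Aux_swap_lower, excess_swap_lower]

theorem hyp3F2Cont_swap_upper (a b c e f : ℂ) :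
    hyp3F2Cont a b c e f = hyp3F2Cont b a c e f := by
  rw [hyp3F2Cont, hyp3F2Cont, hyp3F2Aux_swap_upper, excess_swap_upper]

theorem hyp3F2Cont_swap_upper' (a b c e f : ℂ) :
    hyp3F2Cont a b c e f = hyp3F2Cont a c b e f := by
  rw [hyp3F2Cont, hyp3F2Cont, hyp3F2Aux_swap_upper', excess_swap_upper']

theorem hyp3F2Aux_succ {a b c e f : ℂ} (he : ¬ IsGammaPole e) (hf : ¬ IsGammaPole f)
    (hs : ¬ IsGammaPole (excess a b c e f)) (N : ℕ) (hN : -(N : ℝ) < (excess a b c e f).re) :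
    hyp3F2Aux (N + 1) a b c e f = hyp3F2Aux N a b c e f := by
  induction N generalizing a b c e f with
  | zero =>
    have h := hyp3F2_contiguous he hf (by simpa using hN)
    have e0 := IsGammaPole.ne_zero_of_not he
    have f0 := IsGammaPole.ne_zero_of_not hf
    have s0 := IsGammaPole.ne_zero_of_not hs
    simp only [hyp3F2Aux]
    rw [← h]
    field_simp
  | succ N ih =>
    push_cast at hN
    have h1 := ih (a := a) (b := b) (c := c) (IsGammaPole.not_add_one he)
      (IsGammaPole.not_add_one hf)
      (by rw [excess_add_one_add_one]; exact IsGammaPole.not_add_two hs)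
      (by rw [excess_add_one_add_one, add_re, re_ofNat]; linarith)
    have h2 := ih (a := a + 1) (b := b + 1) (c := c + 1) (IsGammaPole.not_add_two he)
      (IsGammaPole.not_add_two hf)
      (by rw [excess_shift]; exact IsGammaPole.not_add_one hs)
      (by rw [excess_shift, add_re, one_re]; linarith)
    rw [hyp3F2Aux, h1, h2]
    rfl

theorem hyp3F2Aux_add {a b c e f : ℂ} (he : ¬ IsGammaPole e) (hf : ¬ IsGammaPole f)
    (hs : ¬ IsGammaPole (excess a b c e f)) (N M : ℕ) (hN : -(N : ℝ) < (excess a b c e f).re) :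
    hyp3F2Aux (N + M) a b c e f = hyp3F2Aux N a b c e f := by
  induction M with
  | zero => rfl
  | succ M ih =>
    rw [← add_assoc, hyp3F2Aux_succ he hf hs _ (lt_of_le_of_lt _ hN), ih]
    push_cast
    linarith [(M.cast_nonneg : (0 : ℝ) ≤ M)]

theorem hyp3F2Cont_eq_aux {a b c e f : ℂ} (he : ¬ IsGammaPole e) (hf : ¬ IsGammaPole f)
    (hs : ¬ IsGammaPole (excess a b c e f)) (N : ℕ) (hN : -(N : ℝ) < (excess a b c e f).re) :
    hyp3F2Cont a b c e f = hyp3F2Aux N a b c e f := by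
  have h := Nat.lt_floor_add_one (-(excess a b c e f).re)
  rw [hyp3F2Cont, ← hyp3F2Aux_add he hf hs _ N (by push_cast; linarith), add_comm,
    hyp3F2Aux_add he hf hs _ _ hN]

theorem hyp3F2Cont_eq_tsum {a b c e f : ℂ} (he : ¬ IsGammaPole e) (hf : ¬ IsGammaPole f)
    (hs : 0 < (excess a b c e f).re) :
    hyp3F2Cont a b c e f = ∑' k, hyp3F2Term a b c e f k :=
  hyp3F2Cont_eq_aux he hf (not_isGammaPole_of_re_pos hs) 0 (by simpa using hs)

theorem hasSum_hyp3F2Cont {a b c e f : ℂ} (he : ¬ IsGammaPole e) (hf : ¬ IsGammaPole f)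
    (hs : 0 < (excess a b c e f).re) :
    HasSum (hyp3F2Term a b c e f) (hyp3F2Cont a b c e f) := by
  rw [hyp3F2Cont_eq_tsum he hf hs]
  exact hasSum_hyp3F2Term he hf hs

/-! ### Holomorphy in a lower parameter -/

theorem isGammaPole_iff {z : ℂ} : IsGammaPole z ↔ (Gamma z)⁻¹ = 0 := by
  rw [inv_eq_zero]
  exact (Gamma_eq_zero_iff z).symm

theorem isOpen_not_isGammaPole : IsOpen {z : ℂ | ¬ IsGammaPole z} := by
  have : {z : ℂ | ¬ IsGammaPole z} = {z : ℂ | (Gamma z)⁻¹ ≠ 0} := by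
    ext z; simp [isGammaPole_iff]
  rw [this]
  exact isOpen_ne_fun differentiable_one_div_Gamma.continuous continuous_const

theorem countable_isGammaPole : {z : ℂ | IsGammaPole z}.Countable :=
  (Set.countable_range fun m : ℕ => -(m : ℂ)).mono fun _ hz => hz.imp fun _ hm => hm.symm

/-- The lower parameters at which the continuation in that parameter is holomorphic. -/
def hyp3F2Domain (a b c e : ℂ) : Set ℂ :=
  {z | ¬ IsGammaPole z ∧ ¬ IsGammaPole (excess a b c e z)}

theorem continuous_excess (a b c e : ℂ) : Continuous (excess a b c e) := by
  unfold excess; fun_prop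

theorem isOpen_hyp3F2Domain (a b c e : ℂ) : IsOpen (hyp3F2Domain a b c e) :=
  isOpen_not_isGammaPole.inter (isOpen_not_isGammaPole.preimage (continuous_excess a b c e))

theorem isPreconnected_compl_of_countable {s : Set ℂ} (hs : s.Countable) :
    IsPreconnected sᶜ :=
  (hs.isConnected_compl_of_one_lt_rank (by simp)).isPreconnected

theorem isPreconnected_hyp3F2Domain (a b c e : ℂ) : IsPreconnected (hyp3F2Domain a b c e) := by
  have h : hyp3F2Domain a b c e =
      ({z | IsGammaPole z} ∪ excess a b c e ⁻¹' {z | IsGammaPole z})ᶜ := by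
    ext z; simp [hyp3F2Domain]
  rw [h]
  refine isPreconnected_compl_of_countable (countable_isGammaPole.union
    (countable_isGammaPole.preimage_of_injOn fun x _ y _ hxy => ?_))
  simp only [excess] at hxy
  linear_combination hxy

theorem mem_hyp3F2Domain_of_re {a b c e z : ℂ} (hz : 0 < z.re)
    (hs : 0 < (excess a b c e z).re) : z ∈ hyp3F2Domain a b c e :=
  ⟨not_isGammaPole_of_re_pos hz, not_isGammaPole_of_re_pos hs⟩

theorem prod_range_le_prod_max {g : ℕ → ℝ} (J : ℕ) (h0 : ∀ j, 0 ≤ g j)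
    (h1 : ∀ j, J ≤ j → g j ≤ 1) (k : ℕ) :
    ∏ j ∈ Finset.range k, g j ≤ ∏ j ∈ Finset.range J, max 1 (g j) := by
  calc ∏ j ∈ Finset.range k, g j ≤ ∏ j ∈ Finset.range k, max 1 (g j) :=
        Finset.prod_le_prod (fun j _ => h0 j) fun j _ => le_max_right _ _
    _ ≤ ∏ j ∈ Finset.range (max k J), max 1 (g j) := by
        refine Finset.prod_le_prod_of_subset_of_one_le
          (Finset.range_mono (le_max_left _ _)) (fun j _ => ?_) fun j _ _ => le_max_left _ _
        exact zero_le_one.trans (le_max_left _ _)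
    _ = ∏ j ∈ Finset.range J, max 1 (g j) := by
        refine (Finset.prod_subset (Finset.range_mono (le_max_right _ _)) fun j _ hj => ?_).symm
        exact max_eq_left (h1 j (by simpa using hj))

theorem hyp3F2Term_change_lower {a b c e f f' : ℂ} (hf' : ¬ IsGammaPole f') (k : ℕ) :
    hyp3F2Term a b c e f k =
      hyp3F2Term a b c e f' k * ∏ j ∈ Finset.range k, ((f' + j) / (f + j)) := by
  have h := poch_ne_zero hf' k
  rw [Finset.prod_div_distrib, ← poch_eq_prod, ← poch_eq_prod]
  simp only [hyp3F2Term]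
  rw [div_mul_div_comm, mul_comm _ (poch f' k), mul_right_comm (poch e k) (poch f' k),
    mul_comm _ (poch f' k), mul_assoc (poch f' k),
    mul_div_mul_left _ _ h]
  congr 1
  ring

/-- Near a lower parameter where the series converges, all terms are dominated by those of a
convergent series: the real parameter slightly to the left bounds all factors `1 / (z + j)` with
`j` large. -/
theorem exists_summable_bound {a b c e z₀ : ℂ} (he : ¬ IsGammaPole e) (hz : ¬ IsGammaPole z₀)
    (hs : 0 < (excess a b c e z₀).re) :
    ∃ u : ℕ → ℝ, Summable u ∧ ∀ᶠ z in 𝓝 z₀, ∀ k, ‖hyp3F2Term a b c e z k‖ ≤ u k := by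
  -- a real number just below the real part of `z₀`, and not an integer
  obtain ⟨x, hx1, hx2⟩ : ∃ x, max (z₀.re - (excess a b c e z₀).re) (⌈z₀.re⌉ - 1 : ℝ) < x ∧
      x < z₀.re :=
    exists_between (max_lt (by linarith) (by linarith [Int.ceil_lt_add_one z₀.re]))
  rw [max_lt_iff] at hx1
  have hx : ¬ IsGammaPole (x : ℂ) := by
    rintro ⟨m, hm⟩
    have hm' : x = ((-(m : ℤ) : ℤ) : ℝ) := by
      have := congrArg re hm
      simpa using this
    have h1 := Int.le_ceil z₀.re
    have h2 : ⌈z₀.re⌉ - 1 < -(m : ℤ) := by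
      have := hx1.2; rw [hm'] at this; exact_mod_cast this
    have h3 : -(m : ℤ) < ⌈z₀.re⌉ := by
      have := hx2.trans_le h1; rw [hm'] at this; exact_mod_cast this
    omega
  have hsx : 0 < (excess a b c e x).re := by
    have h1 := hx1.1
    simp only [excess, sub_re, add_re, ofReal_re] at h1 ⊢
    linarith
  set J := ⌈-x⌉₊ with hJ
  have hJx : ∀ j : ℕ, J ≤ j → 0 ≤ x + j := fun j hj => by
    have h1 := Nat.le_ceil (-x)
    have h2 : (J : ℝ) ≤ j := by exact_mod_cast hj
    linarith
  set B : ℂ → ℝ := fun z => ∏ j ∈ Finset.range J, max 1 ‖((x : ℂ) + j) / (z + j)‖ with hB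
  have hBc : ContinuousAt B z₀ := by
    refine tendsto_finsetProd _ fun j _ => ?_
    have := IsGammaPole.add_natCast_ne_zero hz j
    exact (continuousAt_const.max (ContinuousAt.norm (by fun_prop (disch := assumption))))
  refine ⟨fun k => ‖hyp3F2Term a b c e x k‖ * (B z₀ + 1),
    (summable_norm_hyp3F2Term he hx hsx).mul_right _, ?_⟩
  have hre : ∀ᶠ z in 𝓝 z₀, x < z.re := continuous_re.continuousAt.eventually_const_lt hx2
  filter_upwards [hre, hBc.eventually_lt_const (lt_add_one _)] with z hzx hzB k
  rw [hyp3F2Term_change_lower hx, norm_mul, norm_prod]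
  refine mul_le_mul_of_nonneg_left (le_trans ?_ hzB.le) (norm_nonneg _)
  refine prod_range_le_prod_max J (fun j => norm_nonneg _) (fun j hj => ?_) k
  rw [norm_div]
  refine div_le_one_of_le₀ ?_ (norm_nonneg _)
  have h1 : ‖(x : ℂ) + j‖ = x + j := by
    rw [← ofReal_natCast, ← ofReal_add, norm_real, Real.norm_of_nonneg (hJx j hj)]
  rw [h1]
  refine le_trans ?_ (re_le_norm _)
  simp only [add_re, natCast_re]
  linarith

theorem differentiableAt_hyp3F2Term {a b c e z : ℂ} (he : ¬ IsGammaPole e)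
    (hz : ¬ IsGammaPole z) (k : ℕ) :
    DifferentiableAt ℂ (fun z => hyp3F2Term a b c e z k) z := by
  simp only [hyp3F2Term]
  have h1 := poch_ne_zero he k
  have h2 := poch_ne_zero hz k
  have h3 : (k.factorial : ℂ) ≠ 0 := by exact_mod_cast k.factorial_ne_zero
  refine (differentiableAt_const _).div ?_ (mul_ne_zero (mul_ne_zero h1 h2) h3)
  exact ((differentiableAt_const _).mul (differentiable_poch k z)).mul (differentiableAt_const _)

theorem differentiableAt_tsum_hyp3F2Term {a b c e z : ℂ} (he : ¬ IsGammaPole e)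
    (hz : ¬ IsGammaPole z) (hs : 0 < (excess a b c e z).re) :
    DifferentiableAt ℂ (fun z => ∑' k, hyp3F2Term a b c e z k) z := by
  obtain ⟨u, hu, h⟩ := exists_summable_bound he hz hs
  obtain ⟨V, hV, hVo, hzV⟩ := eventually_nhds_iff.mp
    (h.and (isOpen_not_isGammaPole.mem_nhds hz))
  refine (differentiableOn_tsum_of_summable_norm hu (fun k w hw => ?_) hVo
    fun k w hw => (hV w hw).1 k).differentiableAt (hVo.mem_nhds hzV)
  exact (differentiableAt_hyp3F2Term he (hV w hw).2 k).differentiableWithinAt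

theorem differentiableAt_hyp3F2Aux {a b c e z : ℂ} (he : ¬ IsGammaPole e) (N : ℕ)
    (hz : z ∈ hyp3F2Domain a b c e) (hN : -(N : ℝ) < (excess a b c e z).re) :
    DifferentiableAt ℂ (fun z => hyp3F2Aux N a b c e z) z := by
  induction N generalizing a b c e z with
  | zero => exact differentiableAt_tsum_hyp3F2Term he hz.1 (by simpa using hN)
  | succ N ih =>
    obtain ⟨hz, hs⟩ := hz
    push_cast at hN
    have h1 := ih (a := a) (b := b) (c := c) (IsGammaPole.not_add_one he) (z := z + 1)
      ⟨IsGammaPole.not_add_one hz,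
        by rw [excess_add_one_add_one]; exact IsGammaPole.not_add_two hs⟩
      (by rw [excess_add_one_add_one, add_re, re_ofNat]; linarith)
    have h2 := ih (a := a + 1) (b := b + 1) (c := c + 1) (IsGammaPole.not_add_two he)
      (z := z + 2) ⟨IsGammaPole.not_add_two hz,
        by rw [excess_shift]; exact IsGammaPole.not_add_one hs⟩
      (by rw [excess_shift, add_re, one_re]; linarith)
    have h1' : DifferentiableAt ℂ (fun z => hyp3F2Aux N a b c (e + 1) (z + 1)) z :=
      DifferentiableAt.comp z (g := fun w => hyp3F2Aux N a b c (e + 1) w) h1 (by fun_prop)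
    have h2' : DifferentiableAt ℂ
        (fun z => hyp3F2Aux N (a + 1) (b + 1) (c + 1) (e + 2) (z + 2)) z :=
      DifferentiableAt.comp z (g := fun w => hyp3F2Aux N (a + 1) (b + 1) (c + 1) (e + 2) w)
        h2 (by fun_prop)
    have e0 := IsGammaPole.ne_zero_of_not he
    have e1 := IsGammaPole.ne_zero_of_not (IsGammaPole.not_add_one he)
    have z0 := IsGammaPole.ne_zero_of_not hz
    have z1 := IsGammaPole.ne_zero_of_not (IsGammaPole.not_add_one hz)
    have s0 := IsGammaPole.ne_zero_of_not hs
    have hd : DifferentiableAt ℂ (excess a b c e) z := by unfold excess; fun_prop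
    simp only [hyp3F2Aux]
    refine DifferentiableAt.div (.add (.mul (by fun_prop) h1') (.mul (.mul (by fun_prop)
      (.div (by fun_prop) (by fun_prop) (mul_ne_zero e1 z1))) h2')) (by fun_prop)
      (mul_ne_zero (mul_ne_zero s0 e0) z0)

theorem differentiableOn_hyp3F2Cont {a b c e : ℂ} (he : ¬ IsGammaPole e) :
    DifferentiableOn ℂ (fun z => hyp3F2Cont a b c e z) (hyp3F2Domain a b c e) := by
  intro z hz
  obtain ⟨N, hN⟩ := exists_nat_gt (-(excess a b c e z).re)
  have hN' : -(N : ℝ) < (excess a b c e z).re := by linarith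
  refine ((differentiableAt_hyp3F2Aux he N hz hN').congr_of_eventuallyEq
    ?_).differentiableWithinAt
  filter_upwards [(isOpen_hyp3F2Domain a b c e).mem_nhds hz,
    (continuous_re.comp (continuous_excess a b c e)).continuousAt.eventually_const_lt hN']
    with w hw hwN
  exact hyp3F2Cont_eq_aux he hw.1 hw.2 N hwN

theorem excess_re_pos_of_lt {a b c e z : ℂ} (h : (a + b + c - e).re < z.re) :
    0 < (excess a b c e z).re := by
  simp only [excess, add_re, sub_re] at h ⊢
  linarith

/-- The identity theorem: relations between continuations need checking only far to the right. -/
theorem eqOn_hyp3F2Domain {a b c e : ℂ} {G H : ℂ → ℂ}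
    (hG : DifferentiableOn ℂ G (hyp3F2Domain a b c e))
    (hH : DifferentiableOn ℂ H (hyp3F2Domain a b c e))
    (h : ∀ z : ℂ, 0 < z.re → 0 < (excess a b c e z).re → G z = H z) :
    Set.EqOn G H (hyp3F2Domain a b c e) := by
  set R : ℝ := max 0 (a + b + c - e).re with hR
  have hp : ∀ z : ℂ, R < z.re → 0 < z.re ∧ 0 < (excess a b c e z).re := fun z hz =>
    ⟨(le_max_left _ _).trans_lt hz, excess_re_pos_of_lt ((le_max_right _ _).trans_lt hz)⟩
  have hR1 : R < (((R + 1 : ℝ) : ℂ)).re := by rw [ofReal_re]; linarith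
  refine (hG.analyticOnNhd (isOpen_hyp3F2Domain a b c e)).eqOn_of_preconnected_of_eventuallyEq
    (hH.analyticOnNhd (isOpen_hyp3F2Domain a b c e)) (isPreconnected_hyp3F2Domain a b c e)
    (z₀ := ((R + 1 : ℝ) : ℂ)) (mem_hyp3F2Domain_of_re (hp _ hR1).1 (hp _ hR1).2) ?_
  filter_upwards [continuous_re.continuousAt.eventually_const_lt hR1] with z hz
  exact h z (hp z hz).1 (hp z hz).2

/-! ### Regularised values -/

/-- `v` is the regularised value of `₃F₂(a, b, c; e, f | 1)`: the continuation if the excess is not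
a pole, or the sum of a terminating series; the two agree where both apply
(`Terminates.hasSum_hyp3F2Cont`). Unlike in `Hyp3F2AtOne`, the lower parameters play the same
role. -/
def IsHyp3F2Value (a b c e f v : ℂ) : Prop :=
  ¬ IsGammaPole e ∧ ¬ IsGammaPole f ∧
    ((¬ IsGammaPole (excess a b c e f) ∧ hyp3F2Cont a b c e f = v) ∨
      (Terminates a b c ∧ HasSum (hyp3F2Term a b c e f) v))

theorem IsHyp3F2Value.swap_lower {a b c e f v : ℂ} (h : IsHyp3F2Value a b c e f v) :
    IsHyp3F2Value a b c f e v := by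
  rw [IsHyp3F2Value, excess_swap_lower, hyp3F2Cont_swap_lower, hyp3F2Term_swap_lower] at h
  exact ⟨h.2.1, h.1, h.2.2⟩

theorem IsHyp3F2Value.swap_upper {a b c e f v : ℂ} (h : IsHyp3F2Value a b c e f v) :
    IsHyp3F2Value b a c e f v := by
  rw [IsHyp3F2Value, excess_swap_upper, hyp3F2Cont_swap_upper, hyp3F2Term_swap_upper] at h
  exact ⟨h.1, h.2.1, h.2.2.imp_right fun h => ⟨by unfold Terminates at *; tauto, h.2⟩⟩

theorem IsHyp3F2Value.swap_upper' {a b c e f v : ℂ} (h : IsHyp3F2Value a b c e f v) :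
    IsHyp3F2Value a c b e f v := by
  rw [IsHyp3F2Value, excess_swap_upper', hyp3F2Cont_swap_upper', hyp3F2Term_swap_upper'] at h
  exact ⟨h.1, h.2.1, h.2.2.imp_right fun h => ⟨by unfold Terminates at *; tauto, h.2⟩⟩

theorem Terminates.exists_differentiableOn {a b c e : ℂ} (h : Terminates a b c)
    (he : ¬ IsGammaPole e) : ∃ G : ℂ → ℂ, DifferentiableOn ℂ G {z | ¬ IsGammaPole z} ∧
      ∀ z, HasSum (hyp3F2Term a b c e z) (G z) := by
  have hN : ∃ N, ∀ z k, N < k → hyp3F2Term a b c e z k = 0 := by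
    rcases h with ⟨m, rfl⟩ | ⟨m, rfl⟩ | ⟨m, rfl⟩ <;>
    exact ⟨m, fun z k hk => by simp [hyp3F2Term, poch_neg_natCast_eq_zero hk]⟩
  obtain ⟨N, hN⟩ := hN
  refine ⟨fun z => ∑ k ∈ Finset.range (N + 1), hyp3F2Term a b c e z k, ?_, fun z => ?_⟩
  · refine DifferentiableOn.fun_sum fun k _ z hz => ?_
    exact (differentiableAt_hyp3F2Term he hz k).differentiableWithinAt
  · refine hasSum_sum_of_ne_finset_zero fun k hk => hN z k ?_
    simpa using hk

theorem Terminates.hasSum_hyp3F2Cont {a b c e f : ℂ} (h : Terminates a b c)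
    (he : ¬ IsGammaPole e) (hf : f ∈ hyp3F2Domain a b c e) :
    HasSum (hyp3F2Term a b c e f) (hyp3F2Cont a b c e f) := by
  obtain ⟨G, hG, hs⟩ := h.exists_differentiableOn he
  have := eqOn_hyp3F2Domain (differentiableOn_hyp3F2Cont he) (hG.mono fun z hz => hz.1)
    fun z hz hsz => (_root_.hasSum_hyp3F2Cont he (not_isGammaPole_of_re_pos hz) hsz).unique (hs z)
  rw [show hyp3F2Cont a b c e f = G f from this hf]
  exact hs f

theorem IsHyp3F2Value.hyp3F2AtOne {a b c e f v : ℂ} (h : IsHyp3F2Value a b c e f v) :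
    Hyp3F2AtOne a b c e f v := by
  obtain ⟨he, hf, ⟨hs, rfl⟩ | ⟨ht, hv⟩⟩ := h
  · refine ⟨?_, hyp3F2Domain a b c e, fun z => hyp3F2Cont a b c e z,
      max 0 (a + b + c - e).re, isOpen_hyp3F2Domain a b c e, isPreconnected_hyp3F2Domain a b c e,
      differentiableOn_hyp3F2Cont he, fun z hz => ?_, ⟨hf, hs⟩, rfl⟩
    · rintro (hs' | ht)
      · exact hasSum_hyp3F2Cont he hf hs'
      · exact ht.hasSum_hyp3F2Cont he ⟨hf, hs⟩
    · have h1 : 0 < z.re := (le_max_left _ _).trans_lt hz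
      have h2 : 0 < (excess a b c e z).re := excess_re_pos_of_lt ((le_max_right _ _).trans_lt hz)
      exact ⟨mem_hyp3F2Domain_of_re h1 h2, hasSum_hyp3F2Cont he (not_isGammaPole_of_re_pos h1) h2⟩
  · obtain ⟨G, hG, hsum⟩ := ht.exists_differentiableOn he
    exact ⟨fun _ => hv, {z | ¬ IsGammaPole z}, G, 0, isOpen_not_isGammaPole,
      isPreconnected_compl_of_countable countable_isGammaPole, hG,
      fun z hz => ⟨not_isGammaPole_of_re_pos hz, hsum z⟩, hf, (hsum f).unique hv⟩

/-! ### Gauss's theorem -/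

theorem hyp3F2Term_succ (a b c e f : ℂ) (k : ℕ) :
    hyp3F2Term a b c e f (k + 1) = hyp3F2Term a b c e f k *
      ((a + k) * (b + k) * (c + k) / ((e + k) * (f + k) * (k + 1))) := by
  simp only [hyp3F2Term, poch_succ, Nat.factorial_succ]
  push_cast
  rw [div_mul_div_comm]
  congr 1 <;> ring

/-- Telescoping for the terms of `₂F₁(b, c; f | 1)`, written as those of `₃F₂(b, c, 1; 1, f | 1)`. -/
theorem sum_range_gauss {b c f : ℂ} (hf : ¬ IsGammaPole f) (K : ℕ) :
    ∑ k ∈ Finset.range (K + 1),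
      (f * (f - b - c) * hyp3F2Term b c 1 1 f k -
        (f - b) * (f - c) * hyp3F2Term b c 1 1 (f + 1) k) =
    -(b * c) * hyp3F2Term (b + 1) (c + 1) 1 1 (f + 1) K := by
  induction K with
  | zero =>
    simp only [zero_add, Finset.sum_range_one, hyp3F2Term_zero]
    ring
  | succ K ih =>
    rw [Finset.sum_range_succ, ih]
    have fK := IsGammaPole.add_one_add_natCast_ne_zero hf K
    have f0 := IsGammaPole.ne_zero_of_not hf
    have fP := poch_ne_zero (IsGammaPole.not_add_one hf) K
    have hK : (K.factorial : ℂ) ≠ 0 := by exact_mod_cast K.factorial_ne_zero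
    have hK1 : (K : ℂ) + 1 ≠ 0 := by exact_mod_cast K.succ_ne_zero
    simp only [hyp3F2Term, poch_one]
    rw [poch_succ_left b, poch_succ_left c, poch_succ_left f, poch_succ (f + 1),
      poch_succ (b + 1), poch_succ (c + 1), Nat.factorial_succ]
    push_cast
    field_simp
    ring

theorem gauss_contiguous {b c f : ℂ} (hf : ¬ IsGammaPole f) (hs : 0 < (f - b - c).re) :
    f * (f - b - c) * ∑' k, hyp3F2Term b c 1 1 f k =
      (f - b) * (f - c) * ∑' k, hyp3F2Term b c 1 1 (f + 1) k := by
  have h1 : ¬ IsGammaPole 1 := not_isGammaPole_of_re_pos (by simp)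
  have e0 : excess b c 1 1 f = f - b - c := by simp only [excess]; ring
  have e1 : excess b c 1 1 (f + 1) = f - b - c + 1 := by simp only [excess]; ring
  have e2 : excess (b + 1) (c + 1) 1 1 (f + 1) = f - b - c - 1 := by simp only [excess]; ring
  have hf1 := IsGammaPole.not_add_one hf
  have s0 := hasSum_hyp3F2Term (a := b) (b := c) (c := 1) h1 hf (by rwa [e0])
  have s1 := hasSum_hyp3F2Term (a := b) (b := c) (c := 1) h1 hf1
    (by rw [e1, add_re, one_re]; linarith)
  have s2 := (tendsto_hyp3F2Term_zero (a := b + 1) (b := c + 1) (c := 1) h1 hf1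
    (by rw [e2, sub_re, one_re]; linarith)).const_mul (-(b * c))
  have := HasSum.add_eq_of_tendsto ((s0.mul_left _).sub (s1.mul_left _)) hasSum_zero s2
    fun K => by simpa using sum_range_gauss hf K
  linear_combination this

theorem tendsto_inv_natCast_add (s : ℂ) : Tendsto (fun n : ℕ => ((n : ℂ) + s)⁻¹) atTop (𝓝 0) := by
  have h := (tendsto_natCast_div_add_atTop s).mul (tendsto_inv_atTop_nhds_zero_nat (𝕜 := ℂ))
  rw [mul_zero] at h
  refine h.congr' ?_
  filter_upwards [eventually_gt_atTop 0] with n hn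
  have hn' : (n : ℂ) ≠ 0 := by exact_mod_cast hn.ne'
  rw [div_eq_mul_inv]
  field_simp

/-- As the lower parameter grows, all terms but the first tend to zero, with dominated sum. -/
theorem tendsto_tsum_gauss {b c f : ℂ} (hf : ¬ IsGammaPole f) (hs : 0 < (f - b - c).re) :
    Tendsto (fun n : ℕ => ∑' k, hyp3F2Term b c 1 1 (f + n) k) atTop (𝓝 1) := by
  have h1 : ¬ IsGammaPole 1 := not_isGammaPole_of_re_pos (by simp)
  obtain ⟨N, hN⟩ := exists_nat_gt (-f.re)
  have hsum : ∑' k : ℕ, (if k = 0 then (1 : ℂ) else 0) = 1 := tsum_ite_eq 0 _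
  have hN0 : (0 : ℝ) ≤ N := N.cast_nonneg
  have hpole := IsGammaPole.not_add_natCast hf N
  suffices h : Tendsto (fun n : ℕ => ∑' k, hyp3F2Term b c 1 1 (f + n) k) atTop
      (𝓝 (∑' k : ℕ, (if k = 0 then (1 : ℂ) else 0))) by rwa [hsum] at h
  refine tendsto_tsum_of_dominated_convergence
    (summable_norm_hyp3F2Term (a := b) (b := c) (c := 1) h1 hpole ?_) (fun k => ?_) ?_
  · simp only [excess, sub_re, add_re, one_re, natCast_re] at hs ⊢
    linarith
  · have h : Tendsto (fun n : ℕ => poch b k * poch c k /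
        (k.factorial : ℂ) * ∏ j ∈ Finset.range k, ((n : ℂ) + (f + j))⁻¹) atTop
        (𝓝 (if k = 0 then (1 : ℂ) else 0)) := by
      have h0 := tendsto_finsetProd (Finset.range k)
        fun j _ => tendsto_inv_natCast_add (f + (j : ℂ))
      have h2 := h0.const_mul (poch b k * poch c k / (k.factorial : ℂ))
      convert h2 using 2
      rcases k with _ | k
      · simp [poch_zero]
      · simp
    refine h.congr fun n => ?_
    have hK : (k.factorial : ℂ) ≠ 0 := by exact_mod_cast k.factorial_ne_zero
    rw [hyp3F2Term, poch_one, poch_eq_prod (f + n), Finset.prod_inv_distrib]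
    have : ∏ j ∈ Finset.range k, ((n : ℂ) + (f + j)) = ∏ j ∈ Finset.range k, (f + n + j) :=
      Finset.prod_congr rfl fun j _ => by ring
    rw [this]
    field_simp
  · filter_upwards [eventually_ge_atTop N] with n hn k
    rw [hyp3F2Term_change_lower hpole, norm_mul, norm_prod]
    refine mul_le_of_le_one_right (norm_nonneg _) (Finset.prod_le_one (fun j _ => norm_nonneg _)
      fun j _ => ?_)
    rw [norm_div]
    refine div_le_one_of_le₀ ?_ (norm_nonneg _)
    have hn' : (N : ℝ) ≤ n := by exact_mod_cast hn
    have hj : (0 : ℝ) ≤ j := j.cast_nonneg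
    rw [Complex.norm_def, Complex.norm_def]
    refine Real.sqrt_le_sqrt ?_
    rw [normSq_apply, normSq_apply]
    simp only [add_re, natCast_re, add_im, natCast_im]
    nlinarith

/-- Gauss's theorem: `₂F₁(b, c; f | 1) = Γ(f) Γ(f - b - c) / (Γ(f - b) Γ(f - c))`. -/
theorem tsum_gauss {b c f : ℂ} (hf : ¬ IsGammaPole f) (hs : 0 < (f - b - c).re) :
    ∑' k, hyp3F2Term b c 1 1 f k =
      Gamma f * Gamma (f - b - c) * (Gamma (f - b))⁻¹ * (Gamma (f - c))⁻¹ := by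
  have hs' := not_isGammaPole_of_re_pos hs
  -- the quotient of rising factorials produced by `n` contiguous steps is itself a term
  have hn : ∀ n : ℕ, hyp3F2Term (f - b) (f - c) 1 f (f - b - c) n *
      ∑' k, hyp3F2Term b c 1 1 (f + n) k = ∑' k, hyp3F2Term b c 1 1 f k := by
    intro n
    induction n with
    | zero => simp [hyp3F2Term_zero]
    | succ n ih =>
      rw [← ih]
      have h := gauss_contiguous (b := b) (c := c) (IsGammaPole.not_add_natCast hf n)
        (by rw [show f + n - b - c = f - b - c + n by ring, add_re, natCast_re]
            have := (n.cast_nonneg : (0 : ℝ) ≤ n); linarith)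
      have q1 := IsGammaPole.add_natCast_ne_zero hf n
      have q2 := IsGammaPole.add_natCast_ne_zero hs' n
      have hK1 : (n : ℂ) + 1 ≠ 0 := by exact_mod_cast n.succ_ne_zero
      rw [hyp3F2Term_succ, Nat.cast_succ, ← add_assoc f (n : ℂ) 1]
      field_simp
      linear_combination -(hyp3F2Term (f - b) (f - c) 1 f (f - b - c) n) * ((n : ℂ) + 1) * h
  have h1 := tendsto_hyp3F2Term_mul_cpow (a := f - b) (b := f - c) (c := 1) hf hs'
  have e0 : excess (f - b) (f - c) 1 f (f - b - c) + 1 = 0 := by simp only [excess]; ring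
  simp only [e0, cpow_zero, mul_one] at h1
  have h2 := h1.mul (tendsto_tsum_gauss hf hs)
  simp only [hn, Gamma_one, inv_one, mul_one] at h2
  exact tendsto_nhds_unique tendsto_const_nhds h2

/-! ### Upper parameter two -/

/-- The telescoping behind `hyp3F2Cont_two`. -/
theorem sum_range_two {a c e f : ℂ} (he : ¬ IsGammaPole e) (hf : ¬ IsGammaPole f) (K : ℕ) :
    ∑ k ∈ Finset.range (K + 1),
      (-excess 2 a c e f * hyp3F2Term 2 a c e f k +
        (a * c - (e - 1) * (f - 1) + excess 2 a c e f) * hyp3F2Term 1 a c e f k) =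
    a * c * hyp3F2Term 1 (a + 1) (c + 1) e f K - (e - 1) * (f - 1) := by
  induction K with
  | zero =>
    simp only [zero_add, Finset.sum_range_one, hyp3F2Term_zero]
    ring
  | succ K ih =>
    rw [Finset.sum_range_succ, ih]
    have eK := IsGammaPole.add_natCast_ne_zero he K
    have fK := IsGammaPole.add_natCast_ne_zero hf K
    have eP := poch_ne_zero he K
    have fP := poch_ne_zero hf K
    have hK : (K.factorial : ℂ) ≠ 0 := by exact_mod_cast K.factorial_ne_zero
    have hK1 : (K : ℂ) + 1 ≠ 0 := by exact_mod_cast K.succ_ne_zero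
    have h2 : poch 2 (K + 1) = ((K + 1 : ℕ).factorial : ℂ) * (K + 2) := by
      have := poch_add_one_mul 1 (K + 1)
      rw [poch_one, one_mul, show (1 : ℂ) + 1 = 2 by norm_num] at this
      rw [this]; push_cast; ring
    simp only [hyp3F2Term, poch_one, h2, excess]
    rw [poch_succ_left a, poch_succ_left c, poch_succ e, poch_succ f,
      poch_succ (a + 1), poch_succ (c + 1), Nat.factorial_succ]
    push_cast
    field_simp
    ring

theorem excess_one (a c e f : ℂ) : excess 1 a c e f = excess 2 a c e f + 1 := by
  simp only [excess]; ring

theorem excess_one_add_one (a c e f : ℂ) :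
    excess 1 (a + 1) (c + 1) e f = excess 2 a c e f - 1 := by
  simp only [excess]; ring

/-- The relation behind the evaluation, for an arbitrary lower parameter `z`. The second
coefficient vanishes when `(a - 1) (c - 1) = (e - 2) (z - 2)`. -/
theorem hyp3F2Cont_two {a c e z : ℂ} (he : ¬ IsGammaPole e) (hz : z ∈ hyp3F2Domain 2 a c e) :
    -excess 2 a c e z * hyp3F2Cont 2 a c e z +
      (a * c - (e - 1) * (z - 1) + excess 2 a c e z) * hyp3F2Cont 1 a c e z =
    -((e - 1) * (z - 1)) := by
  have hsub : hyp3F2Domain 2 a c e ⊆ hyp3F2Domain 1 a c e := fun w hw =>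
    ⟨hw.1, by rw [excess_one]; exact IsGammaPole.not_add_one hw.2⟩
  have hd : Differentiable ℂ (excess 2 a c e) := by unfold excess; fun_prop
  have hd1 : DifferentiableOn ℂ (fun z => hyp3F2Cont 1 a c e z) (hyp3F2Domain 2 a c e) :=
    (differentiableOn_hyp3F2Cont he).mono hsub
  have hd2 : DifferentiableOn ℂ (fun z => hyp3F2Cont 2 a c e z) (hyp3F2Domain 2 a c e) :=
    differentiableOn_hyp3F2Cont he
  have hd' : DifferentiableOn ℂ (excess 2 a c e) (hyp3F2Domain 2 a c e) := hd.differentiableOn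
  refine eqOn_hyp3F2Domain
    (G := fun z => -excess 2 a c e z * hyp3F2Cont 2 a c e z +
      (a * c - (e - 1) * (z - 1) + excess 2 a c e z) * hyp3F2Cont 1 a c e z)
    (H := fun z => -((e - 1) * (z - 1))) (by fun_prop) (by fun_prop) (fun w hw hs => ?_) hz
  have hw' := not_isGammaPole_of_re_pos hw
  have h2 := hasSum_hyp3F2Cont (a := 2) (b := a) (c := c) he hw' hs
  have h1 := hasSum_hyp3F2Cont (a := 1) (b := a) (c := c) he hw'
    (by rw [excess_one, add_re, one_re]; linarith)
  have h3 := ((tendsto_hyp3F2Term_zero (a := 1) (b := a + 1) (c := c + 1) he hw'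
    (by rw [excess_one_add_one, sub_re, one_re]; linarith)).const_mul (a * c)).sub_const
      ((e - 1) * (w - 1))
  have := HasSum.add_eq_of_tendsto ((h2.mul_left (-excess 2 a c e w)).add
    (h1.mul_left (a * c - (e - 1) * (w - 1) + excess 2 a c e w))) hasSum_zero h3
    fun K => by simpa using sum_range_two he hw' K
  linear_combination this

/-- `₃F₂(2, a, c; e, f | 1) = (e - 1) (f - 1) / σ` if `(a - 1) (c - 1) = (e - 2) (f - 2)`. -/
theorem isHyp3F2Value_two {a c e f : ℂ} (h : Admissible 2 a c e f)
    (hc : (a - 1) * (c - 1) = (e - 2) * (f - 2)) (h0 : excess 2 a c e f ≠ 0) :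
    IsHyp3F2Value 2 a c e f ((e - 1) * (f - 1) / excess 2 a c e f) := by
  obtain ⟨he, hf, h⟩ := h
  have hcoef : a * c - (e - 1) * (f - 1) + excess 2 a c e f = 0 := by
    simp only [excess]; linear_combination hc
  refine ⟨he, hf, ?_⟩
  by_cases hs : IsGammaPole (excess 2 a c e f)
  · -- the series terminates, and the telescoping sum is exact from some point on
    refine Or.inr ⟨h.resolve_right (not_not_intro hs), ?_⟩
    have ht := h.resolve_right (not_not_intro hs)
    have hfin : ∃ N, ∀ K, N ≤ K → a * c * hyp3F2Term 1 (a + 1) (c + 1) e f K = 0 := by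
      have key : ∀ K, a * c * hyp3F2Term 1 (a + 1) (c + 1) e f K =
          poch a (K + 1) * poch c (K + 1) * (poch 1 K / (poch e K * poch f K * K.factorial)) := by
        intro K
        rw [hyp3F2Term, poch_succ_left, poch_succ_left]
        ring
      rcases ht with ⟨m, hm⟩ | ⟨m, rfl⟩ | ⟨m, rfl⟩
      · exact absurd ⟨m, hm⟩ (not_isGammaPole_of_re_pos (x := 2) (by simp))
      · exact ⟨m, fun K hK => by rw [key, poch_neg_natCast_eq_zero (by omega)]; ring⟩
      · exact ⟨m, fun K hK => by rw [key, poch_neg_natCast_eq_zero (by omega)]; ring⟩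
    obtain ⟨N, hN⟩ := hfin
    obtain ⟨G, -, hG⟩ := ht.exists_differentiableOn he
    have h3 : Tendsto (fun K => a * c * hyp3F2Term 1 (a + 1) (c + 1) e f K -
        (e - 1) * (f - 1)) atTop (𝓝 (0 - (e - 1) * (f - 1))) := by
      refine Tendsto.sub_const (tendsto_const_nhds.congr' ?_) _
      filter_upwards [eventually_ge_atTop N] with K hK
      exact (hN K hK).symm
    have := HasSum.add_eq_of_tendsto ((hG f).mul_left (-excess 2 a c e f)) hasSum_zero h3
      fun K => by simpa [hcoef] using sum_range_two (a := a) (c := c) he hf K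
    convert hG f using 1
    rw [div_eq_iff h0]
    linear_combination this
  · refine Or.inl ⟨hs, ?_⟩
    have := hyp3F2Cont_two he ⟨hf, hs⟩
    rw [hcoef] at this
    rw [eq_div_iff h0]
    linear_combination -this

/-! ### Excess two -/

theorem sum_range_excess_two {a b c e f : ℂ} (he : ¬ IsGammaPole e) (hf : ¬ IsGammaPole f)
    (hs : excess a b c e f = 2) (hc : a * b + b * c + c * a = (e - 1) * (f - 1)) (K : ℕ) :
    ∑ k ∈ Finset.range (K + 1), hyp3F2Term a b c e f k =
      hyp3F2Term (a + 1) (b + 1) (c + 1) e f K := by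
  induction K with
  | zero => simp [hyp3F2Term_zero]
  | succ K ih =>
    rw [Finset.sum_range_succ, ih, hyp3F2Term_succ (a + 1)]
    have eK := IsGammaPole.add_natCast_ne_zero he K
    have fK := IsGammaPole.add_natCast_ne_zero hf K
    have hK1 : (K : ℂ) + 1 ≠ 0 := by exact_mod_cast K.succ_ne_zero
    have h1 : hyp3F2Term a b c e f (K + 1) = hyp3F2Term (a + 1) (b + 1) (c + 1) e f K *
        (a * b * c / ((e + K) * (f + K) * (K + 1))) := by
      simp only [hyp3F2Term, poch_succ e, poch_succ f, poch_succ_left, Nat.factorial_succ]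
      push_cast
      rw [div_mul_div_comm]
      congr 1 <;> ring
    rw [h1, ← mul_one_add]
    congr 1
    rw [← sub_eq_zero]
    simp only [excess] at hs
    have hp : (e + K) * (f + K) * ((K : ℂ) + 1) + a * b * c -
        (a + 1 + K) * (b + 1 + K) * (c + 1 + K) = 0 := by
      linear_combination ((K : ℂ) + 1) ^ 2 * hs - ((K : ℂ) + 1) * hc
    field_simp
    linear_combination hp

/-- If the excess is `2` and `a b + b c + c a = (e - 1) (f - 1)`, the partial sums have closed
form. -/
theorem isHyp3F2Value_excess_two {a b c e f : ℂ} (he : ¬ IsGammaPole e) (hf : ¬ IsGammaPole f)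
    (hs : excess a b c e f = 2) (hc : a * b + b * c + c * a = (e - 1) * (f - 1)) :
    IsHyp3F2Value a b c e f
      (Gamma e * Gamma f * (Gamma (a + 1))⁻¹ * (Gamma (b + 1))⁻¹ * (Gamma (c + 1))⁻¹) := by
  have hpos : 0 < (excess a b c e f).re := by rw [hs]; simp
  refine ⟨he, hf, Or.inl ⟨not_isGammaPole_of_re_pos hpos, ?_⟩⟩
  have h := tendsto_hyp3F2Term_mul_cpow (a := a + 1) (b := b + 1) (c := c + 1) he hf
  have e0 : excess (a + 1) (b + 1) (c + 1) e f + 1 = 0 := by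
    simp only [excess] at hs ⊢; linear_combination hs
  simp only [e0, cpow_zero, mul_one] at h
  have := HasSum.add_eq_of_tendsto (hasSum_hyp3F2Cont he hf hpos) hasSum_zero h
    fun K => by simpa using sum_range_excess_two he hf hs hc K
  simpa using this

/-! ### Upper and lower parameter differing by two -/

/-- The telescoping behind `hyp3F2Cont_add_two`; the terms of `₂F₁(b - 1, c - 1; f | 1)` are written
as those of `₃F₂(b - 1, c - 1, 1; 1, f | 1)`. -/
theorem sum_range_add_two {a b c f : ℂ} (he : ¬ IsGammaPole (a + 2)) (hf : ¬ IsGammaPole f)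
    (K : ℕ) :
    ∑ k ∈ Finset.range (K + 1),
        (hyp3F2Term a b c (a + 2) f k - (a + 1) * hyp3F2Term (b - 1) (c - 1) 1 1 f k) +
      ∑ k ∈ Finset.range K, ((f - a - 1) * a + (b - a - 1) * (c - a - 1)) / f *
        hyp3F2Term (a + 1) b c (a + 2) (f + 1) k =
    -a * hyp3F2Term (a + 1) b c (a + 2) f K := by
  induction K with
  | zero =>
    simp only [zero_add, Finset.sum_range_one, Finset.sum_range_zero, hyp3F2Term_zero]
    ring
  | succ K ih =>
    rw [Finset.sum_range_succ _ K, Finset.sum_range_succ _ (K + 1)]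
    have f0 := IsGammaPole.ne_zero_of_not hf
    have fK := IsGammaPole.add_natCast_ne_zero hf K
    have eK := IsGammaPole.add_natCast_ne_zero he K
    have fP := poch_ne_zero hf K
    have hK : (K.factorial : ℂ) ≠ 0 := by exact_mod_cast K.factorial_ne_zero
    have hK1 : (K : ℂ) + 1 ≠ 0 := by exact_mod_cast K.succ_ne_zero
    have hf1 : poch (f + 1) K = poch f K * (f + K) / f := by
      rw [eq_div_iff f0, ← poch_add_one_mul]; ring
    have hstep : hyp3F2Term a b c (a + 2) f (K + 1) -
          (a + 1) * hyp3F2Term (b - 1) (c - 1) 1 1 f (K + 1) +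
        ((f - a - 1) * a + (b - a - 1) * (c - a - 1)) / f *
          hyp3F2Term (a + 1) b c (a + 2) (f + 1) K =
        -a * hyp3F2Term (a + 1) b c (a + 2) f (K + 1) -
          -a * hyp3F2Term (a + 1) b c (a + 2) f K := by
      by_cases ha : a + 1 = 0
      · -- only the first two terms are affected by the vanishing of `a + 1`
        obtain rfl : a = -1 := by linear_combination ha
        have hz : ∀ k, poch (-1 + 1) (k + 1) = 0 := fun k => by
          simpa using poch_neg_natCast_eq_zero (m := 0) (k := k + 1) (by omega)
        rcases K with _ | K
        · simp [hyp3F2Term, poch_succ, poch_zero]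
          field_simp
          ring
        · simp only [hyp3F2Term, hz, poch_succ_left (-1) (K + 1)]
          ring
      · have aP : poch (a + 1) K ≠ 0 := by
          refine poch_ne_zero (fun ⟨m, hm⟩ => ?_) K
          rcases m with _ | m
          · exact ha (by simpa using hm)
          · exact he ⟨m, by push_cast at hm; linear_combination hm⟩
        have aK : a + 1 + K ≠ 0 := by
          rcases K with _ | K
          · simpa using ha
          · have := IsGammaPole.add_natCast_ne_zero he K
            intro h
            exact this (by push_cast at h; linear_combination h)
        have h2 : poch (a + 2) K = poch (a + 1) K * (a + 1 + K) / (a + 1) := by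
          rw [eq_div_iff ha, ← poch_add_one_mul, show a + 1 + 1 = a + 2 by ring]; ring
        simp only [hyp3F2Term, poch_one]
        rw [poch_succ (a + 2), h2, poch_succ_left a, poch_succ_left (b - 1),
          poch_succ_left (c - 1), poch_succ (a + 1), poch_succ b, poch_succ c, poch_succ f, hf1,
          sub_add_cancel, sub_add_cancel, Nat.factorial_succ]
        push_cast
        field_simp
        ring
    linear_combination ih + hstep

theorem differentiableOn_Gamma_comp {g : ℂ → ℂ} {s : Set ℂ} (hg : Differentiable ℂ g)
    (h : ∀ z ∈ s, ¬ IsGammaPole (g z)) : DifferentiableOn ℂ (fun z => Gamma (g z)) s :=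
  fun z hz => ((differentiableAt_Gamma (g z) fun m hm => h z hz ⟨m, hm⟩).comp z
    (hg z)).differentiableWithinAt

theorem differentiable_inv_Gamma_comp {g : ℂ → ℂ} (hg : Differentiable ℂ g) :
    Differentiable ℂ fun z => (Gamma (g z))⁻¹ :=
  differentiable_one_div_Gamma.comp hg

/-- The relation behind the evaluation, for an arbitrary lower parameter `z`. -/
theorem hyp3F2Cont_add_two {a b c z : ℂ} (he : ¬ IsGammaPole (a + 2))
    (hz : z ∈ hyp3F2Domain a b c (a + 2)) :
    hyp3F2Cont a b c (a + 2) z =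
      (a + 1) * (Gamma z * Gamma (excess a b c (a + 2) z) * (Gamma (z - b + 1))⁻¹ *
        (Gamma (z - c + 1))⁻¹) -
      ((z - a - 1) * a + (b - a - 1) * (c - a - 1)) / z *
        hyp3F2Cont (a + 1) b c (a + 2) (z + 1) := by
  have hex : ∀ w, excess (a + 1) b c (a + 2) (w + 1) = excess a b c (a + 2) w := fun w => by
    simp only [excess]; ring
  have hd : Differentiable ℂ (excess a b c (a + 2)) := by unfold excess; fun_prop
  have g1 : DifferentiableOn ℂ (fun w => Gamma w) (hyp3F2Domain a b c (a + 2)) :=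
    differentiableOn_Gamma_comp differentiable_id fun w hw => hw.1
  have g2 : DifferentiableOn ℂ (fun w => Gamma (excess a b c (a + 2) w))
      (hyp3F2Domain a b c (a + 2)) := differentiableOn_Gamma_comp hd fun w hw => hw.2
  have g3 := (differentiable_inv_Gamma_comp (g := fun w => w - b + 1)
    (by fun_prop)).differentiableOn (s := hyp3F2Domain a b c (a + 2))
  have g4 := (differentiable_inv_Gamma_comp (g := fun w => w - c + 1)
    (by fun_prop)).differentiableOn (s := hyp3F2Domain a b c (a + 2))
  have g5 : DifferentiableOn ℂ (fun w => hyp3F2Cont (a + 1) b c (a + 2) (w + 1))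
      (hyp3F2Domain a b c (a + 2)) :=
    (differentiableOn_hyp3F2Cont (a := a + 1) (b := b) (c := c) he).comp (by fun_prop)
      fun w hw => ⟨IsGammaPole.not_add_one hw.1, by rw [hex]; exact hw.2⟩
  have g6 : DifferentiableOn ℂ
      (fun w : ℂ => ((w - a - 1) * a + (b - a - 1) * (c - a - 1)) / w)
      (hyp3F2Domain a b c (a + 2)) :=
    DifferentiableOn.div (by fun_prop) (by fun_prop) fun w hw => IsGammaPole.ne_zero_of_not hw.1
  refine eqOn_hyp3F2Domain (H := fun z => (a + 1) * (Gamma z * Gamma (excess a b c (a + 2) z) *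
      (Gamma (z - b + 1))⁻¹ * (Gamma (z - c + 1))⁻¹) -
      ((z - a - 1) * a + (b - a - 1) * (c - a - 1)) / z *
        hyp3F2Cont (a + 1) b c (a + 2) (z + 1))
    (differentiableOn_hyp3F2Cont he) (((((g1.mul g2).mul g3).mul g4).const_mul _).sub
      (g6.mul g5)) (fun w hw hs => ?_) hz
  have hw' := not_isGammaPole_of_re_pos hw
  have h1 : ¬ IsGammaPole 1 := not_isGammaPole_of_re_pos (by simp)
  have eg : w - (b - 1) - (c - 1) = excess a b c (a + 2) w := by simp only [excess]; ring
  have eg' : excess (b - 1) (c - 1) 1 1 w = excess a b c (a + 2) w := by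
    simp only [excess]; ring
  have et : excess (a + 1) b c (a + 2) w = excess a b c (a + 2) w - 1 := by
    simp only [excess]; ring
  have s0 := hasSum_hyp3F2Cont he hw' hs
  have s1 := hasSum_hyp3F2Term (a := b - 1) (b := c - 1) (c := 1) h1 hw' (by rwa [eg'])
  rw [tsum_gauss hw' (by rwa [eg]), eg, show w - (b - 1) = w - b + 1 by ring,
    show w - (c - 1) = w - c + 1 by ring] at s1
  have s2 := hasSum_hyp3F2Cont (a := a + 1) (b := b) (c := c) he (IsGammaPole.not_add_one hw')
    (by rwa [hex])
  have s3 := (tendsto_hyp3F2Term_zero (a := a + 1) (b := b) (c := c) he hw'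
    (by rw [et, sub_re, one_re]; linarith)).const_mul (-a)
  have := HasSum.add_eq_of_tendsto (s0.sub (s1.mul_left (a + 1)))
    (s2.mul_left (((w - a - 1) * a + (b - a - 1) * (c - a - 1)) / w)) s3
    (sum_range_add_two he hw')
  linear_combination this

theorem inv_Gamma_eq_mul (s : ℂ) : (Gamma s)⁻¹ = s * (Gamma (s + 1))⁻¹ :=
  one_div_Gamma_eq_self_mul_one_div_Gamma_add_one s

/-- If `(f - a - 1) a + (b - a - 1) (c - a - 1) = 0`, then `₃F₂(a, b, c; a + 2, f | 1)` is
`(a + 1) ₂F₁(b - 1, c - 1; f | 1)`. -/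
theorem isHyp3F2Value_add_two {a b c e f : ℂ} (hea : e = a + 2) (he : ¬ IsGammaPole e)
    (hf : ¬ IsGammaPole f) (hs : ¬ IsGammaPole (excess a b c e f))
    (hc : (f - a - 1) * a + (b - a - 1) * (c - a - 1) = 0) :
    IsHyp3F2Value a b c e f (Gamma e * Gamma f * Gamma (excess a b c e f) *
      (Gamma (a + 1))⁻¹ * (Gamma (f - b + 1))⁻¹ * (Gamma (f - c + 1))⁻¹) := by
  subst hea
  refine ⟨he, hf, Or.inl ⟨hs, ?_⟩⟩
  rw [hyp3F2Cont_add_two he ⟨hf, hs⟩, hc, inv_Gamma_eq_mul (a + 1),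
    show a + 1 + 1 = a + 2 by ring]
  have := Gamma_ne_zero_of_not_isGammaPole he
  field_simp
  ring

/-- The value `(e - 1) (f - 1) / σ` as a quotient of Gamma functions. -/
theorem isHyp3F2Value_two_Gamma {a c e f : ℂ} (he : ¬ IsGammaPole e)
    (hf : ¬ IsGammaPole f) (hs : ¬ IsGammaPole (excess 2 a c e f))
    (hc : (a - 1) * (c - 1) = (e - 2) * (f - 2)) :
    IsHyp3F2Value 2 a c e f (Gamma e * Gamma f * Gamma (excess 2 a c e f) *
      (Gamma (e - 1))⁻¹ * (Gamma (f - 1))⁻¹ * (Gamma (excess 2 a c e f + 1))⁻¹) := by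
  have h0 := IsGammaPole.ne_zero_of_not hs
  convert isHyp3F2Value_two ⟨he, hf, Or.inr hs⟩ hc h0 using 1
  rw [inv_Gamma_eq_mul (e - 1), inv_Gamma_eq_mul (f - 1), sub_add_cancel, sub_add_cancel,
    Gamma_add_one _ h0]
  have := Gamma_ne_zero_of_not_isGammaPole he
  have := Gamma_ne_zero_of_not_isGammaPole hf
  have := Gamma_ne_zero_of_not_isGammaPole hs
  field_simp

/-! ### Gamma function identities -/

/-- The reflection formula for `1 / Γ`, valid also where `1 - x` is a pole. -/
theorem inv_Gamma_one_sub {x : ℂ} (hx : ¬ IsGammaPole x) :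
    (Gamma (1 - x))⁻¹ = Gamma x * sin (Real.pi * x) / Real.pi := by
  have h := Gamma_mul_Gamma_one_sub x
  have hG := Gamma_ne_zero_of_not_isGammaPole hx
  have hp : (Real.pi : ℂ) ≠ 0 := by exact_mod_cast Real.pi_ne_zero
  by_cases hs : sin (Real.pi * x) = 0
  · rw [hs, div_zero] at h
    rw [hs, (mul_eq_zero.mp h).resolve_left hG]
    simp
  · rw [inv_eq_of_mul_eq_one_left]
    rw [eq_div_iff hs] at h
    field_simp
    linear_combination h

theorem neg_one_pow_mul_self (n : ℕ) : ((-1 : ℂ) ^ n) * (-1) ^ n = 1 := by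
  rw [← mul_pow]; simp

theorem sin_pi_mul_add_natCast (x : ℂ) (n : ℕ) :
    sin (Real.pi * (x + n)) = (-1) ^ n * sin (Real.pi * x) := by
  rw [mul_add, mul_comm (Real.pi : ℂ) n, sin_antiperiodic.add_nat_mul_eq]

theorem sin_pi_mul_sub_natCast (x : ℂ) (n : ℕ) :
    sin (Real.pi * (x - n)) = (-1) ^ n * sin (Real.pi * x) := by
  rw [mul_sub, mul_comm (Real.pi : ℂ) n, sin_antiperiodic.sub_nat_mul_eq]

theorem inv_Gamma_neg_sub_natCast {a : ℂ} {n : ℕ} (h : ¬ IsGammaPole (1 + a + n)) :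
    (Gamma (-a - n))⁻¹ = -((-1) ^ n * sin (Real.pi * a) * Gamma (1 + a + n) / Real.pi) := by
  have := inv_Gamma_one_sub h
  rw [show 1 - (1 + a + n) = -a - n by ring, show 1 + a + (n : ℂ) = a + ((n + 1 : ℕ) : ℂ) by
    push_cast; ring, sin_pi_mul_add_natCast, pow_succ] at this
  rw [this, show a + ((n + 1 : ℕ) : ℂ) = 1 + a + n by push_cast; ring]
  ring

theorem inv_Gamma_natCast_sub {a : ℂ} {n : ℕ} (h : ¬ IsGammaPole (a - n + 1)) :
    (Gamma (n - a))⁻¹ = -((-1) ^ n * sin (Real.pi * a) * Gamma (a - n + 1) / Real.pi) := by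
  have := inv_Gamma_one_sub h
  rw [show 1 - (a - n + 1) = n - a by ring, show a - n + 1 = a - n + ((1 : ℕ) : ℂ) by
    push_cast; ring, sin_pi_mul_add_natCast, sin_pi_mul_sub_natCast] at this
  rw [this, show a - n + ((1 : ℕ) : ℂ) = a - n + 1 by push_cast; ring]
  ring

theorem not_isGammaPole_natCast_add_half (n : ℕ) : ¬ IsGammaPole (1 / 2 + (n : ℂ)) :=
  not_isGammaPole_of_re_pos (by simp only [add_re, natCast_re]; norm_num; positivity)

/-- A half-integer is not a pole of the Gamma function. -/
theorem not_isGammaPole_of_two_mul_odd {x : ℂ} {k : ℤ} (h : 2 * x = 2 * (k : ℂ) + 1) :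
    ¬ IsGammaPole x := by
  rintro ⟨m, rfl⟩
  have : 2 * (-(m : ℤ)) = 2 * k + 1 := by exact_mod_cast h
  omega

/-- All quotients of Gamma functions in the one-parameter family reduce to this one by
reflection. -/
theorem Gamma_quotient_eq {n : ℕ} {a : ℂ} (h : ¬ IsGammaPole (a - n + 1 / 2)) :
    (2 * a / 3 + 1 / 3) * Gamma (-3 * n + 5 / 2) * Gamma (a - n + 1 / 2) *
      (Gamma (3 / 2 + a - 3 * n))⁻¹ * (Gamma (3 / 2 - n))⁻¹ * (Gamma (1 / 2 + n))⁻¹ *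
      (Gamma (2 * a + 2))⁻¹ * (Gamma (3 * n - a - 1 / 2))⁻¹ =
    (Gamma (3 * n - 1 / 2))⁻¹ * (Gamma (n - a + 1 / 2))⁻¹ * (Gamma (2 * a + 1))⁻¹ := by
  have hp : (Real.pi : ℂ) ≠ 0 := by exact_mod_cast Real.pi_ne_zero
  have h1 : (Gamma (2 * a + 1))⁻¹ = (2 * a + 1) * (Gamma (2 * a + 2))⁻¹ := by
    rw [inv_Gamma_eq_mul, show 2 * a + 1 + 1 = 2 * a + 2 by ring]
  have h2 : (Gamma (n - a + 1 / 2))⁻¹ =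
      (-1) ^ n * Gamma (a - n + 1 / 2) * cos (Real.pi * a) / Real.pi := by
    have := inv_Gamma_one_sub h
    rw [show 1 - (a - n + 1 / 2) = n - a + 1 / 2 by ring] at this
    rw [this, show a - n + 1 / 2 = a + 1 / 2 - n by ring, sin_pi_mul_sub_natCast,
      show Real.pi * (a + 1 / 2) = Real.pi * a + Real.pi / 2 by ring, sin_add_pi_div_two]
    ring
  have h3 : (Gamma (3 / 2 + a - 3 * n))⁻¹ * (Gamma (3 * n - a - 1 / 2))⁻¹ =
      -((-1) ^ n * cos (Real.pi * a) / Real.pi) := by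
    have := Gamma_mul_Gamma_one_sub (3 / 2 + a - 3 * n)
    rw [show 1 - (3 / 2 + a - 3 * n) = 3 * n - a - 1 / 2 by ring,
      show 3 / 2 + a - 3 * n = a + 1 / 2 + (1 : ℕ) - (3 * n : ℕ) by push_cast; ring,
      sin_pi_mul_sub_natCast, sin_pi_mul_add_natCast,
      show Real.pi * (a + 1 / 2) = Real.pi * a + Real.pi / 2 by ring, sin_add_pi_div_two,
      pow_mul, show (-1 : ℂ) ^ 3 = -1 by norm_num] at this
    rw [← mul_inv, show 3 / 2 + a - 3 * n = a + 1 / 2 + (1 : ℕ) - (3 * n : ℕ) by push_cast; ring,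
      this, inv_div]
    ring
  have h4 : Gamma (-3 * n + 5 / 2) * Gamma (3 * n - 1 / 2) =
      -(3 / 2 - 3 * n) * ((-1) ^ n * Real.pi) := by
    have h0 : (3 / 2 - 3 * n : ℂ) ≠ 0 := IsGammaPole.ne_zero_of_not
      (not_isGammaPole_of_two_mul_odd (k := 1 - 3 * n) (by push_cast; ring))
    have := Gamma_mul_Gamma_one_sub (3 / 2 - 3 * n)
    rw [show (-3 * n + 5 / 2 : ℂ) = 3 / 2 - 3 * n + 1 by ring, Gamma_add_one _ h0, mul_assoc,
      show (3 * n - 1 / 2 : ℂ) = 1 - (3 / 2 - 3 * n) by ring, this,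
      show (3 / 2 - 3 * n : ℂ) = 0 + 1 / 2 + (1 : ℕ) - (3 * n : ℕ) by push_cast; ring,
      sin_pi_mul_sub_natCast, sin_pi_mul_add_natCast,
      show (Real.pi : ℂ) * (0 + 1 / 2) = Real.pi / 2 by ring, sin_pi_div_two, pow_mul,
      show (-1 : ℂ) ^ 3 = -1 by norm_num, pow_one]
    have := neg_one_pow_mul_self n
    field_simp
    linear_combination (3 - 2 * ((3 * n : ℕ) : ℂ)) * this
  have h5 : Gamma (3 / 2 - n) * Gamma (1 / 2 + n) = (1 / 2 - n) * ((-1) ^ n * Real.pi) := by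
    have h0 : (1 / 2 - n : ℂ) ≠ 0 := IsGammaPole.ne_zero_of_not
      (not_isGammaPole_of_two_mul_odd (k := -n) (by push_cast; ring))
    have := Gamma_mul_Gamma_one_sub (1 / 2 - n)
    rw [show (3 / 2 - n : ℂ) = 1 / 2 - n + 1 by ring, Gamma_add_one _ h0, mul_assoc,
      show (1 / 2 + n : ℂ) = 1 - (1 / 2 - n) by ring, this, sin_pi_mul_sub_natCast,
      show (Real.pi : ℂ) * (1 / 2) = Real.pi / 2 by ring, sin_pi_div_two]
    have := neg_one_pow_mul_self n
    field_simp
    linear_combination (2 * (n : ℂ) - 1) * this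
  have n1 := Gamma_ne_zero_of_not_isGammaPole (not_isGammaPole_of_two_mul_odd
    (x := 3 * (n : ℂ) - 1 / 2) (k := 3 * n - 1) (by push_cast; ring))
  have n2 := Gamma_ne_zero_of_not_isGammaPole (not_isGammaPole_of_two_mul_odd
    (x := 3 / 2 - (n : ℂ)) (k := 1 - n) (by push_cast; ring))
  have n3 := Gamma_ne_zero_of_not_isGammaPole (not_isGammaPole_natCast_add_half n)
  have h6 : Gamma (-3 * n + 5 / 2) * (Gamma (3 / 2 - n))⁻¹ * (Gamma (1 / 2 + n))⁻¹ =
      -3 * (Gamma (3 * n - 1 / 2))⁻¹ := by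
    generalize Gamma (3 / 2 - (n : ℂ)) = B at *
    generalize Gamma (-3 * (n : ℂ) + 5 / 2) = E at *
    generalize Gamma (1 / 2 + (n : ℂ)) = C at *
    generalize Gamma (3 * (n : ℂ) - 1 / 2) = D at *
    field_simp
    linear_combination h4 + 3 * h5
  rw [h1, h2]
  linear_combination ((2 * a / 3 + 1 / 3) * Gamma (a - n + 1 / 2) * (Gamma (2 * a + 2))⁻¹ *
    ((Gamma (3 / 2 + a - 3 * n))⁻¹ * (Gamma (3 * n - a - 1 / 2))⁻¹)) * h6 +
    ((2 * a / 3 + 1 / 3) * Gamma (a - n + 1 / 2) * (Gamma (2 * a + 2))⁻¹ *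
    (-3 * (Gamma (3 * n - 1 / 2))⁻¹)) * h3

/-- `Gamma_quotient_eq` with the factor `1 / Γ(2 a + 2)` moved across. -/
theorem Gamma_quotient_eq' {n : ℕ} {a : ℂ} (h : ¬ IsGammaPole (a - n + 1 / 2))
    (h1 : ¬ IsGammaPole (2 * a + 2)) :
    (2 * a / 3 + 1 / 3) * Gamma (-3 * n + 5 / 2) * Gamma (a - n + 1 / 2) *
      (Gamma (3 / 2 + a - 3 * n))⁻¹ * (Gamma (3 / 2 - n))⁻¹ * (Gamma (1 / 2 + n))⁻¹ *
      (Gamma (3 * n - a - 1 / 2))⁻¹ =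
    Gamma (2 * a + 2) *
      ((Gamma (3 * n - 1 / 2))⁻¹ * (Gamma (n - a + 1 / 2))⁻¹ * (Gamma (2 * a + 1))⁻¹) := by
  rw [← Gamma_quotient_eq h, mul_right_comm _ (Gamma (2 * a + 2))⁻¹, mul_comm (Gamma (2 * a + 2)),
    inv_mul_cancel_right₀ (Gamma_ne_zero_of_not_isGammaPole h1)]

/-- `Gamma_quotient_eq` with the factor `1 / Γ(3 n - a - 1 / 2)` moved across. -/
theorem Gamma_quotient_eq'' {n : ℕ} {a : ℂ} (h : ¬ IsGammaPole (a - n + 1 / 2))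
    (h1 : ¬ IsGammaPole (3 * n - a - 1 / 2)) :
    (2 * a / 3 + 1 / 3) * Gamma (-3 * n + 5 / 2) * Gamma (a - n + 1 / 2) *
      (Gamma (3 / 2 + a - 3 * n))⁻¹ * (Gamma (3 / 2 - n))⁻¹ * (Gamma (1 / 2 + n))⁻¹ *
      (Gamma (2 * a + 2))⁻¹ =
    Gamma (3 * n - a - 1 / 2) *
      ((Gamma (3 * n - 1 / 2))⁻¹ * (Gamma (n - a + 1 / 2))⁻¹ * (Gamma (2 * a + 1))⁻¹) := by
  rw [← Gamma_quotient_eq h, mul_comm (Gamma (3 * n - a - 1 / 2)),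
    inv_mul_cancel_right₀ (Gamma_ne_zero_of_not_isGammaPole h1)]

/-! ### The evaluations with named Gamma arguments -/

theorem IsHyp3F2Value.of_add_two {a b c e f s x y z v : ℂ} (hea : e = a + 2)
    (he : ¬ IsGammaPole e) (hf : ¬ IsGammaPole f) (hs : ¬ IsGammaPole s)
    (hexc : e + f - a - b - c = s)
    (hc : (f - a - 1) * a + (b - a - 1) * (c - a - 1) = 0)
    (hx : a + 1 = x) (hy : f - b + 1 = y) (hz : f - c + 1 = z)
    (hv : v = Gamma e * Gamma f * Gamma s * (Gamma x)⁻¹ * (Gamma y)⁻¹ * (Gamma z)⁻¹) :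
    IsHyp3F2Value a b c e f v := by
  subst hexc hx hy hz hv
  exact isHyp3F2Value_add_two hea he hf hs hc

theorem IsHyp3F2Value.of_two {a c e f s x y z v : ℂ}
    (he : ¬ IsGammaPole e) (hf : ¬ IsGammaPole f) (hs : ¬ IsGammaPole s)
    (hexc : e + f - 2 - a - c = s) (hc : (a - 1) * (c - 1) = (e - 2) * (f - 2))
    (hx : e - 1 = x) (hy : f - 1 = y) (hz : s + 1 = z)
    (hv : v = Gamma e * Gamma f * Gamma s * (Gamma x)⁻¹ * (Gamma y)⁻¹ * (Gamma z)⁻¹) :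
    IsHyp3F2Value 2 a c e f v := by
  subst hexc hx hy hz hv
  exact isHyp3F2Value_two_Gamma he hf hs hc

theorem IsHyp3F2Value.of_excess_two {a b c e f x y z v : ℂ}
    (he : ¬ IsGammaPole e) (hf : ¬ IsGammaPole f) (hexc : e + f - a - b - c = 2)
    (hc : a * b + b * c + c * a = (e - 1) * (f - 1))
    (hx : a + 1 = x) (hy : b + 1 = y) (hz : c + 1 = z)
    (hv : v = Gamma e * Gamma f * (Gamma x)⁻¹ * (Gamma y)⁻¹ * (Gamma z)⁻¹) :
    IsHyp3F2Value a b c e f v := by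
  subst hx hy hz hv
  exact isHyp3F2Value_excess_two he hf hexc hc

theorem IsHyp3F2Value.of_two' {a c e f s v : ℂ} (h : Admissible 2 a c e f)
    (hc : (a - 1) * (c - 1) = (e - 2) * (f - 2)) (hexc : e + f - 2 - a - c = s) (h0 : s ≠ 0)
    (hv : v * s = (e - 1) * (f - 1)) : IsHyp3F2Value 2 a c e f v := by
  subst hexc
  rw [← eq_div_iff h0] at hv
  exact hv ▸ isHyp3F2Value_two h hc h0

theorem Admissible.swap_upper {a b c e f : ℂ} (h : Admissible a b c e f) :
    Admissible b a c e f := by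
  unfold Admissible at *
  rw [excess_swap_upper b a]
  exact ⟨h.1, h.2.1, h.2.2.imp_left fun h => by unfold Terminates at *; tauto⟩

/-! ### Two evaluations needing separate arguments -/

/-- A shared form of two of the evaluations, with `X = ν (b - 1) / (ν + 1 - a)`. -/
theorem isHyp3F2Value_of_sub_one {ν a b X : ℂ} (hX : X * (ν + 1 - a) = ν * (b - 1))
    (h1 : b - a + ν ≠ 0) (h2 : a - 1 ≠ 0) (h3 : ¬ IsGammaPole (2 - a + (b - 1 - X)))
    (h4 : ¬ IsGammaPole (2 - b + X)) (he : ¬ IsGammaPole (a + X))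
    (hf : ¬ IsGammaPole (a - ν + 1)) :
    IsHyp3F2Value a b (a - ν - 1) (a + X) (a - ν + 1)
      (sin (Real.pi * (b - a - X)) * (ν - a) * (b * ν - a + 1) * Gamma (a + X) *
          Gamma (2 - a + (b - 1 - X)) * Gamma (2 - b + X) /
          ((b - a + ν) * (a - 1) * Real.pi * Gamma (2 + X))) := by
  have hp : (Real.pi : ℂ) ≠ 0 := by exact_mod_cast Real.pi_ne_zero
  refine (IsHyp3F2Value.of_add_two (a := a - ν - 1) (b := a) (c := b) (s := 2 - b + X)
    (x := a - ν) (y := 1 + X) (z := a + X - b + 1) (by ring) hf he h4 (by ring) ?_ (by ring)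
    (by ring) (by ring) ?_).swap_upper.swap_upper'.swap_lower
  · linear_combination -hX
  · have hG := Gamma_ne_zero_of_not_isGammaPole hf
    have h5 := inv_Gamma_one_sub h3
    rw [inv_Gamma_eq_mul, show 1 - (2 - a + (b - 1 - X)) = a + X - b by ring,
      show 2 - a + (b - 1 - X) = b - a - X + (1 : ℕ) by push_cast; ring, sin_pi_mul_add_natCast,
      show b - a - X + ((1 : ℕ) : ℂ) = 2 - a + (b - 1 - X) by push_cast; ring, pow_one] at h5
    rw [inv_Gamma_eq_mul (a - ν), inv_Gamma_eq_mul (1 + X), show 1 + X + 1 = 2 + X by ring]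
    -- both reductions use the relation that defines `X`
    have hy : (a + X - b) * (ν + 1 - a) = (a - 1) * (b - a + ν) := by linear_combination hX
    have hz : (1 + X) * (ν + 1 - a) = b * ν - a + 1 := by linear_combination hX
    have hd : ν + 1 - a ≠ 0 := fun h => by
      rw [h, mul_zero] at hy
      exact mul_ne_zero h2 h1 hy.symm
    rw [← hz]
    have hy' : a + X - b ≠ 0 := fun h => by
      rw [h, zero_mul] at hy
      exact mul_ne_zero h2 h1 hy.symm
    have h6 : (Gamma (a + X - b + 1))⁻¹ = Gamma (2 - a + (b - 1 - X)) *
        (-sin (Real.pi * (b - a - X))) / Real.pi / (a + X - b) := by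
      rw [eq_div_iff hy']
      linear_combination h5
    rw [h6, show (b - a + ν) * (a - 1) * Real.pi * Gamma (2 + X) =
      (a + X - b) * (ν + 1 - a) * Real.pi * Gamma (2 + X) by rw [hy]; ring]
    generalize Gamma (2 - a + (b - 1 - X)) = A at *
    generalize sin (Real.pi * (b - a - X)) = S at *
    rw [div_eq_mul_inv, mul_inv]
    generalize (Gamma (2 + X))⁻¹ = B at *
    field_simp
    ring

/-- Reversing the order of the factors of a rising factorial. -/
theorem poch_reflect (x : ℂ) (n : ℕ) :
    poch (-x - n) (n + 1) = (-1) ^ (n + 1) * poch x (n + 1) := by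
  rw [poch_eq_prod, poch_eq_prod, ← Finset.prod_range_reflect]
  have : (-1 : ℂ) ^ (n + 1) = ∏ _j ∈ Finset.range (n + 1), (-1 : ℂ) := by simp
  rw [this, ← Finset.prod_mul_distrib]
  refine Finset.prod_congr rfl fun j hj => ?_
  have : j ≤ n := Nat.lt_succ_iff.mp (Finset.mem_range.mp hj)
  rw [show n + 1 - 1 - j = n - j by omega, Nat.cast_sub this]
  ring

/-- Unlike for `Γ` itself, no condition on poles is needed. -/
theorem inv_Gamma_eq_poch_mul (x : ℂ) (n : ℕ) :
    (Gamma x)⁻¹ = poch x n * (Gamma (x + n))⁻¹ := by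
  induction n with
  | zero => simp [poch_zero]
  | succ n ih =>
    rw [ih, inv_Gamma_eq_mul (x + n), poch_succ]
    push_cast
    rw [add_assoc x]
    ring

/-- If the excess `1 + s n` is a pole, then `a - 1` must be one of the two values `0`, `-1` for
which the series terminates although `a + 1` is not a pole. -/
theorem eq_zero_or_one_of_isGammaPole {n : ℕ} {a s : ℂ} (hn : 1 ≤ n)
    (h2 : poch (-s * n - n) (n + 1) ≠ 0) (he : ¬ IsGammaPole (a + 1))
    (hf : ¬ IsGammaPole (-s * (a - n - 1) + n + 1)) (hs : IsGammaPole (1 + s * n))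
    (ht : Terminates (-s * a + s + 1) (a - 1) (n + 1)) : a = 0 ∨ a = 1 := by
  obtain ⟨k, hk⟩ := hs
  rcases ht with ⟨m, hm⟩ | ⟨m, hm⟩ | ⟨m, hm⟩
  · -- here the second lower parameter would be a pole, or the denominator would vanish
    exfalso
    rcases lt_or_ge k n with hkn | hkn
    · refine h2 ?_
      have : -s * n - n = -((n - 1 - k : ℕ) : ℂ) := by
        rw [Nat.cast_sub (by omega), Nat.cast_sub hn]
        push_cast
        linear_combination -hk
      rw [this]
      exact poch_neg_natCast_eq_zero (by omega)
    · refine hf ⟨m + 1 + (k - n), ?_⟩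
      push_cast [Nat.cast_sub hkn]
      linear_combination hm + hk
  · rcases m with _ | _ | m
    · right
      push_cast at hm
      linear_combination hm
    · left
      push_cast at hm
      linear_combination hm
    · exact absurd ⟨m, by push_cast at hm; linear_combination hm⟩ he
  · exact absurd ⟨m, hm⟩ (not_isGammaPole_of_re_pos (by simp; positivity))

theorem hasSum_hyp3F2Term_of_zero (a c e f : ℂ) : HasSum (hyp3F2Term a 0 c e f) 1 := by
  have h := hasSum_single (f := hyp3F2Term a 0 c e f) 0 fun k hk => by
    have := poch_neg_natCast_eq_zero (m := 0) (Nat.pos_of_ne_zero hk)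
    rw [Nat.cast_zero, neg_zero] at this
    simp [hyp3F2Term, this]
  rwa [hyp3F2Term_zero] at h

theorem hasSum_hyp3F2Term_of_neg_one (a c e f : ℂ) :
    HasSum (hyp3F2Term a (-1) c e f) (1 - a * c / (e * f)) := by
  have h : HasSum (hyp3F2Term a (-1) c e f)
      (∑ k ∈ Finset.range 2, hyp3F2Term a (-1) c e f k) :=
    hasSum_sum_of_ne_finset_zero fun k hk => by
      have := poch_neg_natCast_eq_zero (m := 1) (k := k) (by simpa using hk)
      rw [Nat.cast_one] at this
      simp [hyp3F2Term, this]
  convert h using 1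
  rw [Finset.sum_range_succ, Finset.sum_range_one, hyp3F2Term_succ, hyp3F2Term_zero]
  push_cast
  ring

/-- The reversed Gessel–Stanton evaluation. -/
theorem isHyp3F2Value_gesselStanton {n : ℕ} {a s : ℂ} (hn : 1 ≤ n) (h1 : a - n - 1 ≠ 0)
    (h2 : poch (-s * n - n) (n + 1) ≠ 0)
    (h : Admissible (-s * a + s + 1) (a - 1) (n + 1) (a + 1) (-s * (a - n - 1) + n + 1)) :
    IsHyp3F2Value (-s * a + s + 1) (a - 1) (n + 1) (a + 1) (-s * (a - n - 1) + n + 1)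
      (a * (-n) * poch (s * (a - n - 1) - n) (n + 1) /
        (poch (-s * n - n) (n + 1) * (a - n - 1))) := by
  obtain ⟨he, hf, h⟩ := h
  have hn0 : (n : ℂ) ≠ 0 := by exact_mod_cast (by omega : n ≠ 0)
  have hex : excess (-s * a + s + 1) (a - 1) (n + 1) (a + 1) (-s * (a - n - 1) + n + 1) =
      1 + s * n := by simp only [excess]; ring
  rw [hex] at h
  by_cases hs : IsGammaPole (1 + s * n)
  · have ht := h.resolve_right (not_not_intro hs)
    refine ⟨he, hf, Or.inr ⟨ht, ?_⟩⟩
    rcases eq_zero_or_one_of_isGammaPole hn h2 he hf hs ht with rfl | rfl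
    · have hf0 := IsGammaPole.ne_zero_of_not hf
      rw [zero_sub, zero_mul, zero_mul, zero_div]
      convert hasSum_hyp3F2Term_of_neg_one _ _ _ _ using 1
      rw [eq_comm, sub_eq_zero, eq_comm, div_eq_one_iff_eq (by simpa using hf0)]
      ring
    · rw [sub_self, show s * (1 - n - 1) - n = -s * n - n by ring]
      convert hasSum_hyp3F2Term_of_zero _ _ _ _ using 1
      generalize poch (-s * n - n) (n + 1) = Q at *
      field_simp
      ring
  · refine (IsHyp3F2Value.of_add_two (a := a - 1) (b := -s * a + s + 1) (c := n + 1)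
      (s := 1 + s * n) (x := a) (y := 1 + s * n + n) (z := s * (n + 1 - a) + 1) (by ring) he hf hs
      (by ring) (by ring) (by ring) (by ring) (by ring) ?_).swap_upper
    have hG1 := Gamma_ne_zero_of_not_isGammaPole he
    have hG2 := Gamma_ne_zero_of_not_isGammaPole hf
    have hG3 := Gamma_ne_zero_of_not_isGammaPole hs
    have hG4 := Gamma_ne_zero_of_not_isGammaPole (IsGammaPole.not_add_natCast hs n)
    have h5 := inv_Gamma_eq_poch_mul (1 + s * n) n
    have hx : s * (a - n - 1) - n = -(s * (n + 1 - a)) - n := by ring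
    rw [show -s * n - (n : ℂ) = -(s * n) - n by ring, poch_reflect, poch_succ_left,
      add_comm (s * (n : ℂ))] at h2
    have h6 := right_ne_zero_of_mul h2
    rw [hx, show -s * n - (n : ℂ) = -(s * n) - n by ring, poch_reflect, poch_reflect,
      poch_succ_left, poch_succ_left (s * n), add_comm (s * (n : ℂ)),
      inv_Gamma_eq_poch_mul (s * (n + 1 - a) + 1) n, inv_Gamma_eq_mul a,
      show s * (n + 1 - a) + 1 + n = -s * (a - n - 1) + n + 1 by ring]
    have hsn := left_ne_zero_of_mul h6
    have hQ := right_ne_zero_of_mul h6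
    have hs0 := left_ne_zero_of_mul hsn
    have hm := left_ne_zero_of_mul h2
    have h7 : Gamma (1 + s * n) * (Gamma (1 + s * n + n))⁻¹ = (poch (1 + s * n) n)⁻¹ := by
      field_simp at h5 ⊢
      linear_combination -h5
    have h8 : Gamma (a + 1) * (Gamma (a + 1))⁻¹ = 1 := mul_inv_cancel₀ hG1
    have h9 : Gamma (-s * (a - n - 1) + n + 1) * (Gamma (-s * (a - n - 1) + n + 1))⁻¹ = 1 :=
      mul_inv_cancel₀ hG2
    have hL : a * -n * ((-1) ^ (n + 1) * (s * (n + 1 - a) * poch (s * (n + 1 - a) + 1) n)) /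
        ((-1) ^ (n + 1) * (s * n * poch (1 + s * n) n) * (a - n - 1)) =
        a * poch (s * (n + 1 - a) + 1) n * (poch (1 + s * n) n)⁻¹ := by
      generalize poch (s * (n + 1 - a) + 1) n = P
      generalize poch (1 + s * n) n = Q at *
      field_simp
      ring
    rw [hL, ← h7]
    linear_combination (-(a * poch (s * (n + 1 - a) + 1) n * (Gamma (1 + s * n) *
      (Gamma (1 + s * n + n))⁻¹)) *
      (Gamma (-s * (a - n - 1) + n + 1) * (Gamma (-s * (a - n - 1) + n + 1))⁻¹)) * h8 -
      (a * poch (s * (n + 1 - a) + 1) n * (Gamma (1 + s * n) * (Gamma (1 + s * n + n))⁻¹)) * h9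

/-! ### The evaluations -/

theorem mainTheorem3 :
    -- (1)
    (∀ (n : ℕ) (a s : ℂ), 1 ≤ n →
      a - n - 1 ≠ 0 →
      poch (-s * n - n) (n + 1) ≠ 0 →
      Admissible (-s * a + s + 1) (a - 1) (n + 1) (a + 1) (-s * (a - n - 1) + n + 1) →
      Hyp3F2AtOne (-s * a + s + 1) (a - 1) (n + 1) (a + 1) (-s * (a - n - 1) + n + 1)
        (a * (-n) * poch (s * (a - n - 1) - n) (n + 1) /
          (poch (-s * n - n) (n + 1) * (a - n - 1)))) ∧
    -- (2)
    (∀ (n : ℕ) (a : ℂ),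
      ¬ IsGammaPole (a - n + 1 / 2) →
      Admissible (2 * a) (1 - a) (2 * n) (2 * a + 2) (-a + 3 * n - 1 / 2) →
      Hyp3F2AtOne (2 * a) (1 - a) (2 * n) (2 * a + 2) (-a + 3 * n - 1 / 2)
        ((2 * a + 1) * Gamma (a - n + 1 / 2) * Gamma (-3 * n + 5 / 2) /
          (3 * Gamma (3 / 2 - 3 * n + a) * Gamma (3 / 2 - n)))) ∧
    -- (3)
    (∀ (n : ℕ) (a b : ℂ), 1 ≤ n →
      b - n ≠ 0 →
      sin (Real.pi * a) ≠ 0 →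
      ¬ IsGammaPole (-b) →
      Admissible a b (-(n * (n - b + a) / (b - n))) (1 + b - a * n / (b - n)) (1 + a + n) →
      Hyp3F2AtOne a b (-(n * (n - b + a) / (b - n))) (1 + b - a * n / (b - n)) (1 + a + n)
        ((-1) ^ n * sin (Real.pi * b) * Gamma (1 + b + a * n / (-b + n)) * Gamma (-b) /
          (sin (Real.pi * a) * Gamma (1 + a) * Gamma (-a - n) *
            Gamma (n + 1 + a * n / (-b + n))))) ∧
    -- (4)
    (∀ (n : ℕ) (a : ℂ),
      ¬ IsGammaPole (a - n + 1 / 2) →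
      Admissible (3 * n - 3 / 2) (n - a - 1 / 2) (2 * a) (2 * a + 1 / 2 + n) (3 * n - a - 1 / 2) →
      Hyp3F2AtOne (3 * n - 3 / 2) (n - a - 1 / 2) (2 * a) (2 * a + 1 / 2 + n) (3 * n - a - 1 / 2)
        ((2 * a / 3 + 1 / 3) * Gamma (-3 * n + 5 / 2) * Gamma (a - n + 1 / 2) *
          Gamma (2 * a + 1 / 2 + n) /
          (Gamma (1 / 2 + n) * Gamma (3 / 2 + a - 3 * n) * Gamma (2 * a + 2) *
            Gamma (3 / 2 - n)))) ∧
    -- (5)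
    (∀ (n : ℕ) (a b : ℂ), 1 ≤ n →
      b + n ≠ 0 →
      sin (Real.pi * a) ≠ 0 →
      ¬ IsGammaPole (-b) →
      Admissible a b (-n + a * n / (b + n)) (1 + b + a * n / (b + n)) (a - n + 1) →
      Hyp3F2AtOne a b (-n + a * n / (b + n)) (1 + b + a * n / (b + n)) (a - n + 1)
        ((-1) ^ n * sin (Real.pi * b) * Gamma (1 + b + a * n / (b + n)) * Gamma (-b) /
          (sin (Real.pi * a) * Gamma (1 + a) * Gamma (1 - n + a * n / (b + n)) *
            Gamma (n - a)))) ∧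
    -- (6)
    (∀ (n : ℕ) (a b : ℂ), 1 ≤ n →
      n + 1 - a ≠ 0 →
      b - a + n ≠ 0 →
      a - 1 ≠ 0 →
      ¬ IsGammaPole (2 - a + (-a + 1) * (b - 1) / (n + 1 - a)) →
      ¬ IsGammaPole (2 - b + n * (b - 1) / (n + 1 - a)) →
      Admissible a b (a - n - 1) (a - n * (b - 1) / (a - n - 1)) (a - n + 1) →
      Hyp3F2AtOne a b (a - n - 1) (a - n * (b - 1) / (a - n - 1)) (a - n + 1)
        (sin (Real.pi * (b - a + n * (-b + 1) / (n + 1 - a))) * (n - a) * (b * n - a + 1) *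
          Gamma (a + n * (b - 1) / (n + 1 - a)) *
          Gamma (2 - a + (-a + 1) * (b - 1) / (n + 1 - a)) *
          Gamma (2 - b + n * (b - 1) / (n + 1 - a)) /
          ((b - a + n) * (a - 1) * Real.pi * Gamma (2 + n * (b - 1) / (n + 1 - a))))) ∧
    -- (7)
    (∀ (n : ℕ) (a b : ℂ), 1 ≤ n →
      b - 2 ≠ 0 →
      1 + a - b ≠ 0 →
      b + n - 2 ≠ 0 →
      Admissible 2 a (1 - n) b (2 + n * (-a + 1) / (b - 2)) →
      Hyp3F2AtOne 2 a (1 - n) b (2 + n * (-a + 1) / (b - 2))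
        ((a * n - b - n + 2) * (b - 1) / ((1 + a - b) * (b + n - 2)))) ∧
    -- (8)
    (∀ (n : ℕ) (a b : ℂ), 1 ≤ n →
      ¬ IsGammaPole (-a - n + 1) →
      Admissible a b (-((a - 1) * (b - 1) / n)) (2 + (b - 1) * (-a + 1) / n) (-1 + a + b + n) →
      Hyp3F2AtOne a b (-((a - 1) * (b - 1) / n)) (2 + (b - 1) * (-a + 1) / n) (-1 + a + b + n)
        (sin (Real.pi * a) * (-1) ^ n * (n - a * b + a + b - 1) * Gamma n * Gamma (-a - n + 1) *
          Gamma (-1 + a + b + n) / (Real.pi * Gamma (b + n)))) ∧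
    -- (9)
    (∀ (n : ℕ) (a b : ℂ), 1 ≤ n →
      a + n - 1 ≠ 0 →
      n - b + a ≠ 0 →
      Admissible a 2 b (1 + (b * (a - 1) + n) / (a + n - 1)) (1 + a + n) →
      Hyp3F2AtOne a 2 b (1 + (b * (a - 1) + n) / (a + n - 1)) (1 + a + n)
        ((n + a * b - b) * (a + n) / ((n - b + a) * n))) ∧
    -- (10)
    (∀ (n : ℕ) (a b : ℂ), 1 ≤ n →
      1 + a - b ≠ 0 →
      sin (Real.pi * a) ≠ 0 →
      ¬ IsGammaPole (2 - b - n * (-b + 1) / (b - a - 1)) →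
      ¬ IsGammaPole (n * (b - 1) / (1 + a - b)) →
      Admissible a b (1 + a + a * n / (1 + a - b)) (2 + a) (1 + a + n) →
      Hyp3F2AtOne a b (1 + a + a * n / (1 + a - b)) (2 + a) (1 + a + n)
        (-(sin (Real.pi * n * a / (1 + a - b)) * (1 + a) *
          Gamma (2 - b - n * (-b + 1) / (b - a - 1)) * Gamma (n * (b - 1) / (1 + a - b)) /
          (sin (Real.pi * a) * Gamma (-b + a + 2 + n) * Gamma (-a - n))))) ∧
    -- (11)
    (∀ (n : ℕ) (a b : ℂ), 1 ≤ n →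
      a + n - 1 ≠ 0 →
      n - b + a ≠ 0 →
      a - 1 ≠ 0 →
      ¬ IsGammaPole (1 + (b - 1) * (-a + 1) / (a + n - 1)) →
      ¬ IsGammaPole (2 - a + (b - 1) * (a - 1) / (a + n - 1)) →
      Admissible a b (a + n - 1) (a - 1 + (b * n + a - 1) / (a + n - 1)) (1 + a + n) →
      Hyp3F2AtOne a b (a + n - 1) (a - 1 + (b * n + a - 1) / (a + n - 1)) (1 + a + n)
        (-sin (Real.pi * (a + (-b + 1) * (a - 1) / (a + n - 1))) * (b * n + a - 1) * (a + n) *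
          Gamma (1 + (b - 1) * (-a + 1) / (a + n - 1)) *
          Gamma (a + n * (b - 1) / (a + n - 1)) *
          Gamma (2 - a + (b - 1) * (a - 1) / (a + n - 1)) /
          ((n - b + a) * Real.pi * (a - 1) * Gamma ((b * n + a - 1) / (a + n - 1) + 1)))) ∧
    -- (12)
    (∀ (n : ℕ) (a b : ℂ), 1 ≤ n →
      b - 2 ≠ 0 →
      1 + a - b ≠ 0 →
      n + 2 - b ≠ 0 →
      sin (Real.pi * (n + 2 - b) * (1 + a - b) / (b - 2)) ≠ 0 →
      Admissible 2 a (n + 1) b (2 + n * (a - 1) / (b - 2)) →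
      Hyp3F2AtOne 2 a (n + 1) b (2 + n * (a - 1) / (b - 2))
        (-((-1) ^ n * sin (Real.pi * (b - a + n * (a - 1) / (b - 2))) * (a * n + b - 2 - n) *
          (b - 1) /
          ((1 + a - b) * (n + 2 - b) * sin (Real.pi * (n + 2 - b) * (1 + a - b) / (b - 2)))))) ∧
    -- (13)
    (∀ (n : ℕ) (a b : ℂ), 1 ≤ n →
      a - n - 1 ≠ 0 →
      b - a + n ≠ 0 →
      Admissible a 2 b (2 + (b - 1) * (a - 1) / (a - n - 1)) (a - n + 1) →
      Hyp3F2AtOne a 2 b (2 + (b - 1) * (a - 1) / (a - n - 1)) (a - n + 1)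
        ((n - a) * (n - a * b + b) / ((b - a + n) * n))) ∧
    -- (14)
    (∀ (n : ℕ) (a b : ℂ), 1 ≤ n →
      1 + a - b ≠ 0 →
      sin (Real.pi * a) ≠ 0 →
      ¬ IsGammaPole (2 - b + n * (b - 1) / (1 + a - b)) →
      ¬ IsGammaPole (-(n * (b - 1) / (1 + a - b))) →
      Admissible a b (1 + a - a * n / (1 + a - b)) (2 + a) (a - n + 1) →
      Hyp3F2AtOne a b (1 + a - a * n / (1 + a - b)) (2 + a) (a - n + 1)
        ((1 + a) * sin (Real.pi * a * n / (1 + a - b)) *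
          Gamma (2 - b + n * (b - 1) / (1 + a - b)) * Gamma (-(n * (b - 1) / (1 + a - b))) /
          (sin (Real.pi * a) * Gamma (-b + a + 2 - n) * Gamma (n - a)))) ∧
    -- (15)
    (∀ (n : ℕ) (a : ℂ),
      ¬ IsGammaPole (a - n + 1 / 2) →
      ¬ IsGammaPole (1 - a) →
      Admissible (1 / 2 + n) (3 * n - 3 / 2) (3 * a + 1) (2 * a + 1 / 2 + n) (1 / 2 + 3 * n) →
      Hyp3F2AtOne (1 / 2 + n) (3 * n - 3 / 2) (3 * a + 1) (2 * a + 1 / 2 + n) (1 / 2 + 3 * n)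
        ((2 * a / 3 + 1 / 3) * Gamma (-3 * n + 5 / 2) * Gamma (a - n + 1 / 2) *
          Gamma (1 - a) * Gamma (1 / 2 + 3 * n) * Gamma (2 * a + 1 / 2 + n) /
          (Gamma (3 * n - a - 1 / 2) * Gamma (1 / 2 + n) * Gamma (3 / 2 + a - 3 * n) *
            Gamma (2 * a + 2) * Gamma (3 / 2 - n)))) ∧
    -- (16)
    (∀ (n : ℕ) (a : ℂ),
      ¬ IsGammaPole (a - n + 1 / 2) →
      ¬ IsGammaPole (2 * n) →
      Admissible (1 / 2 + n) (n - a - 1 / 2) (2 * a + 2 - 2 * n) (2 * a + 1 / 2 + n)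
          (3 / 2 - a + n) →
      Hyp3F2AtOne (1 / 2 + n) (n - a - 1 / 2) (2 * a + 2 - 2 * n) (2 * a + 1 / 2 + n)
          (3 / 2 - a + n)
        ((2 * a / 3 + 1 / 3) * Gamma (2 * n) * Gamma (-3 * n + 5 / 2) *
          Gamma (a - n + 1 / 2) * Gamma (3 / 2 - a + n) * Gamma (2 * a + 1 / 2 + n) /
          (Gamma (3 * n - a - 1 / 2) * Gamma (1 / 2 + n) * Gamma (3 / 2 + a - 3 * n) *
            Gamma (2 * a + 2) * Gamma (3 / 2 - n)))) ∧
    -- (17)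
    (∀ (n : ℕ) (a : ℂ),
      ¬ IsGammaPole (a - n + 1 / 2) →
      ¬ IsGammaPole (3 * n - 3 * a - 1 / 2) →
      Admissible (3 * a + 1) (2 * a + 2 - 2 * n) (2 * a) (2 * a + 1 / 2 + n) (2 * a + 2) →
      Hyp3F2AtOne (3 * a + 1) (2 * a + 2 - 2 * n) (2 * a) (2 * a + 1 / 2 + n) (2 * a + 2)
        ((2 * a / 3 + 1 / 3) * Gamma (-3 * n + 5 / 2) * Gamma (a - n + 1 / 2) *
          Gamma (2 * a + 1 / 2 + n) * Gamma (3 * n - 3 * a - 1 / 2) /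
          (Gamma (3 * n - a - 1 / 2) * Gamma (1 / 2 + n) * Gamma (3 / 2 + a - 3 * n) *
            Gamma (3 / 2 - n)))) ∧
    -- (18)
    (∀ (n : ℕ) (a : ℂ),
      ¬ IsGammaPole (a - n + 1 / 2) →
      ¬ IsGammaPole (2 * a) →
      Admissible (1 / 2 + n) (3 * n - 3 * a - 1 / 2) 2 (1 / 2 + 3 * n) (3 / 2 - a + n) →
      Hyp3F2AtOne (1 / 2 + n) (3 * n - 3 * a - 1 / 2) 2 (1 / 2 + 3 * n) (3 / 2 - a + n)
        ((2 * a / 3 + 1 / 3) * Gamma (-3 * n + 5 / 2) * Gamma (a - n + 1 / 2) *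
          Gamma (2 * a) * Gamma (3 / 2 - a + n) * Gamma (1 / 2 + 3 * n) /
          (Gamma (3 * n - a - 1 / 2) * Gamma (1 / 2 + n) * Gamma (3 / 2 + a - 3 * n) *
            Gamma (2 * a + 2) * Gamma (3 / 2 - n)))) ∧
    -- (19)
    (∀ (n : ℕ) (a : ℂ),
      ¬ IsGammaPole (a - n + 1 / 2) →
      ¬ IsGammaPole (2 * a + 2 - 2 * n) →
      Admissible (3 * n - 3 / 2) (3 * n - 3 * a - 1 / 2) (2 * n) (1 / 2 + 3 * n)
          (3 * n - a - 1 / 2) →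
      Hyp3F2AtOne (3 * n - 3 / 2) (3 * n - 3 * a - 1 / 2) (2 * n) (1 / 2 + 3 * n)
          (3 * n - a - 1 / 2)
        ((2 * a / 3 + 1 / 3) * Gamma (2 * a + 2 - 2 * n) * Gamma (-3 * n + 5 / 2) *
          Gamma (a - n + 1 / 2) * Gamma (1 / 2 + 3 * n) /
          (Gamma (1 / 2 + n) * Gamma (3 / 2 + a - 3 * n) * Gamma (2 * a + 2) *
            Gamma (3 / 2 - n)))) ∧
    -- (20)
    (∀ (n : ℕ) (a : ℂ),
      ¬ IsGammaPole (a - n + 1 / 2) →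
      ¬ IsGammaPole (n - a - 1 / 2) →
      Admissible (3 * a + 1) 2 (2 * n) (1 / 2 + 3 * n) (2 * a + 2) →
      Hyp3F2AtOne (3 * a + 1) 2 (2 * n) (1 / 2 + 3 * n) (2 * a + 2)
        ((2 * a / 3 + 1 / 3) * Gamma (n - a - 1 / 2) * Gamma (-3 * n + 5 / 2) *
          Gamma (a - n + 1 / 2) * Gamma (1 / 2 + 3 * n) /
          (Gamma (3 * n - a - 1 / 2) * Gamma (1 / 2 + n) * Gamma (3 / 2 + a - 3 * n) *
            Gamma (3 / 2 - n)))) ∧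
    -- (21)
    (∀ (n : ℕ) (a : ℂ),
      ¬ IsGammaPole (a - n + 1 / 2) →
      ¬ IsGammaPole (3 * a + 1) →
      Admissible (n - a - 1 / 2) (3 * n - 3 * a - 1 / 2) (1 - a) (3 / 2 - a + n)
          (3 * n - a - 1 / 2) →
      Hyp3F2AtOne (n - a - 1 / 2) (3 * n - 3 * a - 1 / 2) (1 - a) (3 / 2 - a + n)
          (3 * n - a - 1 / 2)
        ((2 * a / 3 + 1 / 3) * Gamma (-3 * n + 5 / 2) * Gamma (a - n + 1 / 2) *
          Gamma (3 * a + 1) * Gamma (3 / 2 - a + n) /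
          (Gamma (1 / 2 + n) * Gamma (3 / 2 + a - 3 * n) * Gamma (2 * a + 2) *
            Gamma (3 / 2 - n)))) ∧
    -- (22)
    (∀ (n : ℕ) (a : ℂ),
      ¬ IsGammaPole (a - n + 1 / 2) →
      Admissible (2 * a + 2 - 2 * n) 2 (1 - a) (3 / 2 - a + n) (2 * a + 2) →
      Hyp3F2AtOne (2 * a + 2 - 2 * n) 2 (1 - a) (3 / 2 - a + n) (2 * a + 2)
        ((2 * a / 3 + 1 / 3) * Gamma (3 * n - 3 / 2) * Gamma (-3 * n + 5 / 2) *
          Gamma (a - n + 1 / 2) * Gamma (3 / 2 - a + n) /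
          (Gamma (3 * n - a - 1 / 2) * Gamma (1 / 2 + n) * Gamma (3 / 2 + a - 3 * n) *
            Gamma (3 / 2 - n)))) := by
  refine ⟨?_, ?_, ?_, ?_, ?_, ?_, ?_, ?_, ?_, ?_, ?_, ?_, ?_, ?_, ?_, ?_, ?_, ?_, ?_, ?_, ?_, ?_⟩
  · intro n a s hn h1 h2 h
    exact (isHyp3F2Value_gesselStanton hn h1 h2 h).hyp3F2AtOne
  · rintro n a h1 ⟨he, hf, -⟩
    have hK := Gamma_quotient_eq' h1 he
    have hf' : ¬ IsGammaPole (3 * n - a - 1 / 2) := by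
      rwa [show (3 * n - a - 1 / 2 : ℂ) = -a + 3 * n - 1 / 2 by ring]
    have h2 := Gamma_ne_zero_of_not_isGammaPole hf'
    have h3 := Gamma_ne_zero_of_not_isGammaPole (not_isGammaPole_natCast_add_half n)
    refine (IsHyp3F2Value.of_add_two (s := 1 / 2 + n) (x := 2 * a + 1) (y := 3 * n - 1 / 2)
      (z := n - a + 1 / 2) (by ring) he hf (not_isGammaPole_natCast_add_half n) (by ring)
      (by ring) (by ring) (by ring) (by ring) ?_).hyp3F2AtOne
    -- the common quotient lacks two Gamma factors, which are inserted next to their inverses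
    rw [show -a + 3 * n - 1 / 2 = 3 * n - a - 1 / 2 by ring,
      show 3 / 2 - 3 * n + a = 3 / 2 + a - 3 * n by ring]
    calc _ = (2 * a / 3 + 1 / 3) * Gamma (-3 * n + 5 / 2) * Gamma (a - n + 1 / 2) *
          (Gamma (3 / 2 + a - 3 * n))⁻¹ * (Gamma (3 / 2 - n))⁻¹ := by ring
      _ = (2 * a / 3 + 1 / 3) * Gamma (-3 * n + 5 / 2) * Gamma (a - n + 1 / 2) *
          (Gamma (3 / 2 + a - 3 * n))⁻¹ * (Gamma (3 / 2 - n))⁻¹ *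
          (Gamma (1 / 2 + n) * (Gamma (1 / 2 + n))⁻¹) *
          (Gamma (3 * n - a - 1 / 2) * (Gamma (3 * n - a - 1 / 2))⁻¹) := by
        rw [mul_inv_cancel₀ h2, mul_inv_cancel₀ h3, mul_one, mul_one]
      _ = _ := by
        linear_combination Gamma (1 / 2 + n) * Gamma (3 * n - a - 1 / 2) * hK
  · rintro n a b - h1 h2 h3 ⟨he, hf, -⟩
    have e1 : 1 + b + a * n / (-b + n) = 1 + b - a * n / (b - n) := by
      rw [show -b + (n : ℂ) = -(b - n) by ring, div_neg]; ring
    refine (IsHyp3F2Value.of_excess_two (x := 1 + a) (y := 1 - -b) (z := n + 1 + a * n / (-b + n))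
      he hf (by field_simp; ring) (by field_simp; ring) (by ring) (by ring) ?_ ?_).hyp3F2AtOne
    · rw [show -b + (n : ℂ) = -(b - n) by ring, div_neg]; field_simp; ring
    rw [e1, div_eq_mul_inv, mul_inv, mul_inv, mul_inv, inv_Gamma_neg_sub_natCast hf,
      inv_Gamma_one_sub h3, mul_neg (Real.pi : ℂ), sin_neg]
    have hm := neg_one_pow_mul_self n
    generalize ((-1 : ℂ) ^ n) = ε at *
    generalize Gamma (1 + b - a * n / (b - n)) = E
    generalize (Gamma (n + 1 + a * n / (-b + n)))⁻¹ = C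
    generalize Gamma (1 + a + n) = F
    field_simp
    linear_combination -(sin (Real.pi * b) * E * Gamma (-b) * F * (Gamma (1 + a))⁻¹ * C) * hm
  · rintro n a h1 ⟨he, hf, -⟩
    have hK := Gamma_quotient_eq'' h1 hf
    refine (IsHyp3F2Value.of_excess_two (x := 3 * n - 1 / 2) (y := n - a + 1 / 2)
      (z := 2 * a + 1) he hf (by ring) (by ring) (by ring) (by ring) (by ring)
      ?_).hyp3F2AtOne
    linear_combination Gamma (2 * a + 1 / 2 + n) * hK
  · rintro n a b - h1 h2 h3 ⟨he, hf, -⟩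
    refine (IsHyp3F2Value.of_excess_two (x := 1 + a) (y := 1 - -b) (z := 1 - n + a * n / (b + n))
      he hf (by ring) (by field_simp; ring) (by ring) (by ring) (by ring) ?_).hyp3F2AtOne
    rw [div_eq_mul_inv, mul_inv, mul_inv, mul_inv, inv_Gamma_natCast_sub hf,
      inv_Gamma_one_sub h3, mul_neg (Real.pi : ℂ), sin_neg]
    have hm := neg_one_pow_mul_self n
    generalize ((-1 : ℂ) ^ n) = ε at *
    generalize Gamma (1 + b + a * n / (b + n)) = E
    generalize (Gamma (1 - n + a * n / (b + n)))⁻¹ = C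
    generalize Gamma (a - n + 1) = F
    field_simp
    linear_combination -(sin (Real.pi * b) * E * Gamma (-b) * F * (Gamma (1 + a))⁻¹ * C) * hm
  · rintro n a b - h1 h2 h3 h4 h5 ⟨he, hf, -⟩
    -- every Gamma argument is a polynomial in `a`, `b` and the quotient `X`
    obtain ⟨X, hX⟩ : ∃ X, X = n * (b - 1) / (n + 1 - a) := ⟨_, rfl⟩
    have hX' : X * (n + 1 - a) = n * (b - 1) := by rw [hX]; field_simp
    have r1 : a - n * (b - 1) / (a - n - 1) = a + X := by
      rw [hX, show a - (n : ℂ) - 1 = -(n + 1 - a) by ring, div_neg]; ring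
    have r2 : (-a + 1) * (b - 1) / (n + 1 - a) = b - 1 - X := by
      rw [hX]; field_simp; ring
    have r3 : n * (-b + 1) / (n + 1 - a) = -X := by rw [hX]; ring
    rw [r1] at he
    rw [r2] at h4
    rw [← hX] at h5
    rw [r1, r2, r3, ← hX, ← sub_eq_add_neg]
    exact (isHyp3F2Value_of_sub_one hX' h2 h3 h4 h5 he hf).hyp3F2AtOne
  · intro n a b hn h1 h2 h3 h
    have hn0 : (n : ℂ) ≠ 0 := by exact_mod_cast (by omega : n ≠ 0)
    have h3' : b - 2 + n ≠ 0 := by rwa [show b - 2 + n = b + n - 2 by ring]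
    have h2' : b - a - 1 ≠ 0 := by
      rw [show b - a - 1 = -(1 + a - b) by ring]; exact neg_ne_zero.mpr h2
    refine (IsHyp3F2Value.of_two' (s := (b - a - 1) * (b - 2 + n) / (b - 2)) h
      (by field_simp; ring) (by field_simp; ring)
      (div_ne_zero (mul_ne_zero h2' h3') h1) ?_).hyp3F2AtOne
    field_simp
    ring
  · rintro n a b hn h1 ⟨he, hf, -⟩
    have hn0 : (n : ℂ) ≠ 0 := by exact_mod_cast (by omega : n ≠ 0)
    obtain ⟨X, hX⟩ : ∃ X, X = (a - 1) * (b - 1) / n := ⟨_, rfl⟩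
    have hX' : X * n = (a - 1) * (b - 1) := by rw [hX]; field_simp
    have r1 : 2 + (b - 1) * (-a + 1) / n = 2 - X := by rw [hX]; ring
    rw [r1] at he
    rw [r1, ← hX]
    refine (IsHyp3F2Value.of_add_two (a := -X) (b := a) (c := b) (s := n + 1) (x := 1 - X)
      (y := b + n) (z := 1 - (-a - n + 1)) (by ring) he hf
      (not_isGammaPole_of_re_pos (by simp; positivity)) (by ring) ?_ (by ring) (by ring) (by ring)
      ?_).swap_upper.swap_upper'.hyp3F2AtOne
    · linear_combination -hX'
    · have hG := Gamma_ne_zero_of_not_isGammaPole he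
      rw [inv_Gamma_one_sub h1, inv_Gamma_eq_mul (1 - X), Gamma_add_one _ hn0,
        show 1 - X + 1 = 2 - X by ring,
        show (Real.pi : ℂ) * (-a - n + 1) = Real.pi - Real.pi * (a + n) by ring, sin_pi_sub,
        sin_pi_mul_add_natCast]
      field_simp
      linear_combination (sin (Real.pi * a) * Gamma n * Gamma (-a - n + 1) *
        Gamma (-1 + a + b + n) * (Gamma (b + n))⁻¹) * hX'
  · intro n a b hn h1 h2 h
    have hn0 : (n : ℂ) ≠ 0 := by exact_mod_cast (by omega : n ≠ 0)
    refine (IsHyp3F2Value.of_two' (s := n * (n - b + a) / (a + n - 1)) h.swap_upper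
      (by field_simp; ring) (by field_simp; ring)
      (div_ne_zero (mul_ne_zero hn0 h2) h1) ?_).swap_upper.hyp3F2AtOne
    field_simp
    ring
  · rintro n a b - h1 h2 h3 h4 ⟨he, hf, -⟩
    obtain ⟨X, hX⟩ : ∃ X, X = n * (b - 1) / (1 + a - b) := ⟨_, rfl⟩
    have hX' : X * (1 + a - b) = n * (b - 1) := by rw [hX]; field_simp
    have r1 : a * n / (1 + a - b) = n + X := by rw [hX]; field_simp; ring
    have r2 : n * (-b + 1) / (b - a - 1) = X := by
      rw [hX, show b - a - 1 = -(1 + a - b) by ring, div_neg]; ring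
    have r3 : Real.pi * n * a / (1 + a - b) = Real.pi * (X + n) := by
      rw [show Real.pi * n * a / (1 + a - b) = Real.pi * (a * n / (1 + a - b)) by ring, r1]; ring
    rw [r2] at h3
    rw [← hX] at h4
    rw [r1, r2, r3, ← hX]
    refine (IsHyp3F2Value.of_add_two (s := 2 - b - X) (x := a + 1) (y := -b + a + 2 + n)
      (z := 1 - X) (by ring) he hf h3 (by ring) ?_ (by ring) (by ring) (by ring)
      ?_).hyp3F2AtOne
    · linear_combination -hX'
    · have hG := Gamma_ne_zero_of_not_isGammaPole he
      rw [inv_Gamma_one_sub h4, inv_Gamma_eq_mul (a + 1), show a + 1 + 1 = 2 + a by ring,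
        div_eq_mul_inv, mul_inv, mul_inv, inv_Gamma_neg_sub_natCast hf, sin_pi_mul_add_natCast]
      have hm := neg_one_pow_mul_self n
      generalize ((-1 : ℂ) ^ n) = ε at *
      generalize (Gamma (-b + a + 2 + n))⁻¹ = D at *
      field_simp
      linear_combination (sin (Real.pi * X) * (a + 1) * Gamma (2 - b - X) * Gamma X * D *
        Gamma (1 + a + n)) * hm
  · rintro n a b - h1 h2 h3 h4 h5 ⟨he, hf, -⟩
    obtain ⟨X, hX⟩ : ∃ X, X = n * (b - 1) / (a + n - 1) := ⟨_, rfl⟩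
    have hX' : X * (a + n - 1) = n * (b - 1) := by rw [hX]; field_simp
    have r1 : (b * n + a - 1) / (a + n - 1) = 1 + X := by rw [hX]; field_simp; ring
    have r2 : (b - 1) * (-a + 1) / (a + n - 1) = 1 - b + X := by rw [hX]; field_simp; ring
    have r3 : (b - 1) * (a - 1) / (a + n - 1) = b - 1 - X := by rw [hX]; field_simp; ring
    have r4 : (-b + 1) * (a - 1) / (a + n - 1) = 1 - b + X := by rw [hX]; field_simp; ring
    rw [r1, show a - 1 + (1 + X) = a + X by ring] at he
    rw [r2, show 1 + (1 - b + X) = 2 - b + X by ring] at h4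
    rw [r3] at h5
    rw [show 1 + a + (n : ℂ) = a - (-n) + 1 by ring] at hf
    -- this is the shared form at `ν = -n`
    have h2' : b - a + -(n : ℂ) ≠ 0 := by
      rw [show b - a + -(n : ℂ) = -(n - b + a) by ring]; exact neg_ne_zero.mpr h2
    have h := (isHyp3F2Value_of_sub_one (ν := -n) (a := a) (b := b) (X := X)
      (by linear_combination -hX') h2' h3 h5 h4 he hf).hyp3F2AtOne
    rw [show a - -(n : ℂ) - 1 = a + n - 1 by ring,
      show a - -(n : ℂ) + 1 = 1 + a + n by ring] at h
    rw [r1, r2, r3, r4, ← hX, show a - 1 + (1 + X) = a + X by ring,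
      show 1 + (1 - b + X) = 2 - b + X by ring, show 1 + X + 1 = 2 + X by ring,
      show a + (1 - b + X) = -(b - a - X) + (1 : ℕ) by push_cast; ring, sin_pi_mul_add_natCast,
      mul_neg (Real.pi : ℂ), sin_neg]
    convert h using 1
    field_simp
    ring
  · intro n a b hn h1 h2 h3 h4 h
    have hs : (Real.pi : ℂ) * (n + 2 - b) * (1 + a - b) / (b - 2) =
      Real.pi * ((1 + a - b) * (n + 2 - b) / (b - 2)) := by ring
    have hs' : b - a + n * (a - 1) / (b - 2) =
        (1 + a - b) * (n + 2 - b) / (b - 2) + ((n + 1 : ℕ) : ℂ) := by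
      push_cast; field_simp; ring
    rw [hs] at h4
    -- with `σ` the excess, the two sines are those of `π (σ + n + 1)` and `π σ`
    rw [hs, hs', sin_pi_mul_add_natCast, pow_succ]
    refine (IsHyp3F2Value.of_two' (s := (1 + a - b) * (n + 2 - b) / (b - 2)) h
      (by field_simp; ring) (by field_simp; ring)
      (div_ne_zero (mul_ne_zero h2 h3) h1) ?_).hyp3F2AtOne
    have hm := neg_one_pow_mul_self n
    generalize ((-1 : ℂ) ^ n) = ε at *
    generalize sin (Real.pi * ((1 + a - b) * (n + 2 - b) / (b - 2))) = S at *
    field_simp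
    linear_combination (a * n + b - 2 - n) * (b - 1) * hm
  · intro n a b hn h1 h2 h
    have hn0 : (n : ℂ) ≠ 0 := by exact_mod_cast (by omega : n ≠ 0)
    refine (IsHyp3F2Value.of_two' (s := n * (b - a + n) / (a - n - 1)) h.swap_upper
      (by field_simp; ring) (by field_simp; ring)
      (div_ne_zero (mul_ne_zero hn0 h2) h1) ?_).swap_upper.hyp3F2AtOne
    field_simp
    ring
  · rintro n a b - h1 h2 h3 h4 ⟨he, hf, -⟩
    obtain ⟨X, hX⟩ : ∃ X, X = n * (b - 1) / (1 + a - b) := ⟨_, rfl⟩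
    have hX' : X * (1 + a - b) = n * (b - 1) := by rw [hX]; field_simp
    have r1 : a * n / (1 + a - b) = n + X := by rw [hX]; field_simp; ring
    have r3 : Real.pi * a * n / (1 + a - b) = Real.pi * (X + n) := by
      rw [show Real.pi * a * n / (1 + a - b) = Real.pi * (a * n / (1 + a - b)) by ring, r1]; ring
    rw [← hX] at h3 h4
    rw [r1, r3, ← hX]
    refine (IsHyp3F2Value.of_add_two (s := 2 - b + X) (x := a + 1) (y := -b + a + 2 - n)
      (z := 1 - -X) (by ring) he hf h3 (by ring) ?_ (by ring) (by ring) (by ring)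
      ?_).hyp3F2AtOne
    · linear_combination hX'
    · have hG := Gamma_ne_zero_of_not_isGammaPole he
      rw [inv_Gamma_one_sub h4, inv_Gamma_eq_mul (a + 1), show a + 1 + 1 = 2 + a by ring,
        div_eq_mul_inv, mul_inv, mul_inv, inv_Gamma_natCast_sub hf, sin_pi_mul_add_natCast,
        mul_neg (Real.pi : ℂ), sin_neg]
      have hm := neg_one_pow_mul_self n
      generalize ((-1 : ℂ) ^ n) = ε at *
      generalize (Gamma (-b + a + 2 - n))⁻¹ = D at *
      generalize sin (Real.pi * a) = S at *
      field_simp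
      linear_combination -(sin (Real.pi * X) * (a + 1) * Gamma (2 - b + X) * Gamma (-X) * D *
        Gamma (a - n + 1)) * hm
  · rintro n a h1 h2 ⟨he, hf, -⟩
    have hK := Gamma_quotient_eq h1
    refine (IsHyp3F2Value.of_add_two (a := 3 * n - 3 / 2) (b := 1 / 2 + n) (c := 3 * a + 1)
      (s := 1 - a) (x := 3 * n - 1 / 2) (y := 2 * a + 1) (z := n - a + 1 / 2) (by ring) hf he h2
      (by ring) (by ring) (by ring) (by ring) (by ring) ?_).swap_upper.swap_lower.hyp3F2AtOne
    linear_combination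
      Gamma (1 - a) * Gamma (1 / 2 + 3 * n) * Gamma (2 * a + 1 / 2 + n) * hK
  · rintro n a h1 h2 ⟨he, hf, -⟩
    have hK := Gamma_quotient_eq h1
    refine (IsHyp3F2Value.of_add_two (a := n - a - 1 / 2) (b := 1 / 2 + n)
      (c := 2 * a + 2 - 2 * n) (s := 2 * n) (x := n - a + 1 / 2) (y := 2 * a + 1)
      (z := 3 * n - 1 / 2) (by ring) hf he h2
      (by ring) (by ring) (by ring) (by ring) (by ring) ?_).swap_upper.swap_lower.hyp3F2AtOne
    linear_combination
      Gamma (2 * n) * Gamma (3 / 2 - a + n) * Gamma (2 * a + 1 / 2 + n) * hK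
  · rintro n a h1 h2 ⟨he, hf, -⟩
    have hK := Gamma_quotient_eq' h1 hf
    refine (IsHyp3F2Value.of_add_two (a := 2 * a) (b := 3 * a + 1) (c := 2 * a + 2 - 2 * n)
      (s := 3 * n - 3 * a - 1 / 2) (x := 2 * a + 1) (y := n - a + 1 / 2)
      (z := 3 * n - 1 / 2) (by ring) hf he h2 (by ring) (by ring) (by ring) (by ring) (by ring)
      ?_).swap_upper.swap_upper'.swap_lower.hyp3F2AtOne
    linear_combination Gamma (2 * a + 1 / 2 + n) * Gamma (3 * n - 3 * a - 1 / 2) * hK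
  · rintro n a h1 h2 ⟨he, hf, -⟩
    have hK := Gamma_quotient_eq h1
    refine (IsHyp3F2Value.of_two (s := 2 * a) (x := 3 * n - 1 / 2) (y := n - a + 1 / 2)
      (z := 2 * a + 1) he hf h2 (by ring) (by ring) (by ring) (by ring) (by ring)
      ?_).swap_upper.swap_upper'.hyp3F2AtOne
    linear_combination
      Gamma (2 * a) * Gamma (3 / 2 - a + n) * Gamma (1 / 2 + 3 * n) * hK
  · rintro n a h1 h2 ⟨he, hf, -⟩
    have hK := Gamma_quotient_eq'' h1 hf
    refine (IsHyp3F2Value.of_add_two (s := 2 * a + 2 - 2 * n) (x := 3 * n - 1 / 2)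
      (y := 2 * a + 1) (z := n - a + 1 / 2) (by ring) he hf h2
      (by ring) (by ring) (by ring) (by ring) (by ring) ?_).hyp3F2AtOne
    linear_combination Gamma (2 * a + 2 - 2 * n) * Gamma (1 / 2 + 3 * n) * hK
  · rintro n a h1 h2 ⟨he, hf, -⟩
    have hK := Gamma_quotient_eq' h1 hf
    refine (IsHyp3F2Value.of_two (s := n - a - 1 / 2) (x := 3 * n - 1 / 2) (y := 2 * a + 1)
      (z := n - a + 1 / 2) he hf h2 (by ring) (by ring) (by ring) (by ring) (by ring)
      ?_).swap_upper.hyp3F2AtOne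
    linear_combination Gamma (n - a - 1 / 2) * Gamma (1 / 2 + 3 * n) * hK
  · rintro n a h1 h2 ⟨he, hf, -⟩
    have hK := Gamma_quotient_eq'' h1 hf
    refine (IsHyp3F2Value.of_add_two (s := 3 * a + 1) (x := n - a + 1 / 2)
      (y := 2 * a + 1) (z := 3 * n - 1 / 2) (by ring) he hf h2
      (by ring) (by ring) (by ring) (by ring) (by ring) ?_).hyp3F2AtOne
    linear_combination Gamma (3 * a + 1) * Gamma (3 / 2 - a + n) * hK
  · rintro n a h1 ⟨he, hf, -⟩
    have hK := Gamma_quotient_eq' h1 hf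
    refine (IsHyp3F2Value.of_two (s := 3 * n - 3 / 2) (x := n - a + 1 / 2) (y := 2 * a + 1)
      (z := 3 * n - 1 / 2) he hf
      (not_isGammaPole_of_two_mul_odd (k := 3 * n - 2) (by push_cast; ring)) (by ring) (by ring)
      (by ring) (by ring) (by ring) ?_).swap_upper.hyp3F2AtOne
    linear_combination Gamma (3 * n - 3 / 2) * Gamma (3 / 2 - a + n) * hK
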